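/- Let $0<q<1$, $\mathbb{A}=\{z\in\mathbb{C}:q<|z|<1\}$, and let $B=B_1\cup B_q$ be its boundary, where $B_1=\{|z|=1\}$ and $B_q=\{|z|=q\}$. Let $\mu$ be the measure on $B$ that restricts on each of $B_1$, $B_q$ to the multiple of arclength with total mass $2\pi$, and write $L^p(B)=L^p(B,\mu)$. For $\alpha\in[0,1)$ let $H^2_\alpha\subset L^2(B)$ be the closed subspace of boundary functions of those (multivalued) analytic functions $F$ on $\mathbb{A}$ (i.e. analytic functions on the universal cover of $\mathbb{A}$, in coordinates $z=re^{it}$, $q<r<1$, $t\in\mathbb{R}$) that satisfy $$F(r,t+2\pi)=e^{2\pi i\alpha}F(r,t)\quad\text{and}\quad \sup_{q<r<1}\int_{-\pi}^{\pi}|F(r,t)|^2\,dt<\infty,$$ where $F$ is made single-valued on $B$ by the branch $-\pi<t\le\pi$, and boundary functions are limits in $L^2$ as $r\to1$ and $r\to q$. For a real-valued $\phi\in L^\infty(B)$ let $T^\alpha_\phi g=P_\alpha(\phi g)$, $g\in H^2_\alpha$, be the Toeplitz operator, where $P_\alpha$ is the orthogonal projection of $L^2(B)$ onto $H^2_\alpha$.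 Call $\lambda\in\mathbb{C}$ an eigenvalue of $\phi$ relative to $A(\mathbb{A})$ (the algebra of functions continuous on $\overline{\mathbb{A}}$ and analytic in $\mathbb{A}$) if there are $\alpha\in[0,1)$ and a nonzero $g\in H^2_\alpha$ with $T^\alpha_\phi g=\lambda g$. Then for every real-valued $\phi\in L^\infty(B)$ the set of eigenvalues of $\phi$ relative to $A(\mathbb{A})$ is a subset of $\mathbb{R}$ that is either empty, or a single point, or an interval with real endpoints $m<M$ (each endpoint may or may not belong to it). -/

import Mathlib

open MeasureTheory Set Filter Topology
open scoped ENNReal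

noncomputable section

namespace AnnulusToeplitz

/-- Lebesgue measure `dt` on one period `(-π, π]` of the angular variable. -/
def angle : Measure ℝ := volume.restrict (Ioc (-Real.pi) Real.pi)

/-- The parametrization `t ↦ ρ e^{it}` of the circle of radius `ρ` about `0`. -/
def circ (ρ t : ℝ) : ℂ := (ρ : ℂ) * Complex.exp ((t : ℂ) * Complex.I)

/-- Arclength on the circle `|z| = ρ`, rescaled to have total mass `2π` (the image of `dt`). -/
def circleMeasure (ρ : ℝ) : Measure ℂ := angle.map (circ ρ)

/-- The measure `μ = μ₁ + μ_q` carried by the boundary `B = {|z| = 1} ∪ {|z| = q}` of the annulus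
`q < |z| < 1`. The spaces `L²(B)` and `L^∞(B)` are the `Lp` spaces of this measure. -/
def boundaryMeasure (q : ℝ) : Measure ℂ := circleMeasure 1 + circleMeasure q

/-- The universal covering surface of the annulus `q < |z| < 1`, with covering map `exp`.
In the polar coordinates `(r, t)`, `z = r e^{it}`, the point `w` is `log r + i t`. -/
def cover (q : ℝ) : Set ℂ := {w : ℂ | Real.log q < w.re ∧ w.re < 0}

/-- The restriction `t ↦ F (s + i t)` of a function on the covering surface to the line over the
circle of radius `e^s`. -/
def slice (F : ℂ → ℂ) (s t : ℝ) : ℂ := F ((s : ℂ) + (t : ℂ) * Complex.I)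

/-- `F` is an analytic, modulus automorphic function of index `α` on the covering surface
(`F (r, t + 2π) = e^{2πiα} F (r, t)`), whose `L²` means over the circles of radius `r`,
`q < r < 1`, are bounded. (As `|F|` is `2π`-periodic in `t`, the means may be taken over any period;
the zero function has every index.) -/
structure IsHardy (q α : ℝ) (F : ℂ → ℂ) : Prop where
  analytic : DifferentiableOn ℂ F (cover q)
  index : ∀ w ∈ cover q, F (w + 2 * Real.pi * Complex.I) =
    Complex.exp (2 * Real.pi * Complex.I * α) * F w
  bounded_means : ∃ C : NNReal, ∀ s ∈ Ioo (Real.log q) 0, eLpNorm (slice F s) 2 angle ≤ C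

/-- `g`, a function on the boundary `B`, is the boundary function of `F`, in the sense of `L²` limits
over both boundary circles. A multivalued function on the annulus is made single valued on `B` by its
branch with `-π < arg z ≤ π`. -/
structure HasBoundaryValue (q : ℝ) (F g : ℂ → ℂ) : Prop where
  outer_circle :
    Tendsto (fun s : ℝ => eLpNorm (slice F s - g ∘ circ 1) 2 angle) (𝓝[<] 0) (𝓝 0)
  inner_circle :
    Tendsto (fun s : ℝ => eLpNorm (slice F s - g ∘ circ q) 2 angle) (𝓝[>] (Real.log q)) (𝓝 0)

theorem measurable_circ (ρ : ℝ) : Measurable (circ ρ) := by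
  unfold circ; fun_prop

theorem quasi_one (q : ℝ) :
    Measure.QuasiMeasurePreserving (circ 1) angle (boundaryMeasure q) :=
  ⟨measurable_circ 1, (Measure.le_add_right le_rfl).absolutelyContinuous⟩

theorem quasi_q (q : ℝ) :
    Measure.QuasiMeasurePreserving (circ q) angle (boundaryMeasure q) :=
  ⟨measurable_circ q, (Measure.le_add_left le_rfl).absolutelyContinuous⟩

theorem continuous_slice {q : ℝ} {F : ℂ → ℂ} (h : DifferentiableOn ℂ F (cover q)) {s : ℝ}
    (hs : s ∈ Ioo (Real.log q) 0) : Continuous (slice F s) := by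
  unfold slice
  refine h.continuousOn.comp_continuous (by fun_prop) (fun t => ?_)
  simpa [cover] using hs

theorem IsHardy.add {q α : ℝ} {F G : ℂ → ℂ} (hF : IsHardy q α F) (hG : IsHardy q α G) :
    IsHardy q α (F + G) where
  analytic := hF.analytic.add hG.analytic
  index w hw := by simp only [Pi.add_apply, hF.index w hw, hG.index w hw]; ring
  bounded_means := by
    obtain ⟨C, hC⟩ := hF.bounded_means
    obtain ⟨D, hD⟩ := hG.bounded_means
    refine ⟨C + D, fun s hs => ?_⟩
    have := eLpNorm_add_le (μ := angle) (p := 2)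
      (continuous_slice hF.analytic hs).aestronglyMeasurable
      (continuous_slice hG.analytic hs).aestronglyMeasurable (by norm_num)
    refine this.trans ?_
    push_cast
    exact add_le_add (hC s hs) (hD s hs)

theorem IsHardy.smul {q α : ℝ} {F : ℂ → ℂ} (hF : IsHardy q α F) (c : ℂ) :
    IsHardy q α (c • F) where
  analytic := hF.analytic.const_smul c
  index w hw := by simp only [Pi.smul_apply, hF.index w hw, smul_eq_mul]; ring
  bounded_means := by
    obtain ⟨C, hC⟩ := hF.bounded_means
    refine ⟨‖c‖₊ * C, fun s hs => ?_⟩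
    have : slice (c • F) s = c • slice F s := rfl
    rw [this, eLpNorm_const_smul]
    push_cast
    exact mul_le_mul_right (hC s hs) _

theorem tendsto_add_aux {l : Filter ℝ} {F G : ℂ → ℂ} {a b : ℝ → ℂ}
    (hmF : ∀ᶠ s in l, AEStronglyMeasurable (slice F s) angle)
    (hmG : ∀ᶠ s in l, AEStronglyMeasurable (slice G s) angle)
    (ha : AEStronglyMeasurable a angle) (hb : AEStronglyMeasurable b angle)
    (h1 : Tendsto (fun s => eLpNorm (slice F s - a) 2 angle) l (𝓝 0))
    (h2 : Tendsto (fun s => eLpNorm (slice G s - b) 2 angle) l (𝓝 0)) :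
    Tendsto (fun s => eLpNorm (slice (F + G) s - (a + b)) 2 angle) l (𝓝 0) := by
  have h := h1.add h2
  rw [add_zero] at h
  refine tendsto_of_tendsto_of_tendsto_of_le_of_le' tendsto_const_nhds h
    (Eventually.of_forall fun _ => zero_le) ?_
  filter_upwards [hmF, hmG] with s hs1 hs2
  have : slice (F + G) s - (a + b) = (slice F s - a) + (slice G s - b) := by
    funext t; simp only [slice, Pi.add_apply, Pi.sub_apply]; ring
  rw [this]
  exact eLpNorm_add_le (hs1.sub ha) (hs2.sub hb) (by norm_num)

theorem eventually_outer {q : ℝ} (hq : q ∈ Ioo (0 : ℝ) 1) {F : ℂ → ℂ}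
    (h : DifferentiableOn ℂ F (cover q)) :
    ∀ᶠ s in 𝓝[<] (0 : ℝ), AEStronglyMeasurable (slice F s) angle := by
  filter_upwards [Ioo_mem_nhdsLT (Real.log_neg hq.1 hq.2)] with s hs
  exact (continuous_slice h hs).aestronglyMeasurable

theorem eventually_inner {q : ℝ} (hq : q ∈ Ioo (0 : ℝ) 1) {F : ℂ → ℂ}
    (h : DifferentiableOn ℂ F (cover q)) :
    ∀ᶠ s in 𝓝[>] (Real.log q), AEStronglyMeasurable (slice F s) angle := by
  filter_upwards [Ioo_mem_nhdsGT (Real.log_neg hq.1 hq.2)] with s hs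
  exact (continuous_slice h hs).aestronglyMeasurable

theorem HasBoundaryValue.congr {q : ℝ} {F g h : ℂ → ℂ} (hF : HasBoundaryValue q F g)
    (hgh : g =ᵐ[boundaryMeasure q] h) : HasBoundaryValue q F h where
  outer_circle := hF.outer_circle.congr fun s => eLpNorm_congr_ae <| by
    filter_upwards [(quasi_one q).ae hgh] with t ht
    simp [ht]
  inner_circle := hF.inner_circle.congr fun s => eLpNorm_congr_ae <| by
    filter_upwards [(quasi_q q).ae hgh] with t ht
    simp [ht]

theorem tendsto_smul_aux {l : Filter ℝ} {F : ℂ → ℂ} {a : ℝ → ℂ} (c : ℂ)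
    (h : Tendsto (fun s => eLpNorm (slice F s - a) 2 angle) l (𝓝 0)) :
    Tendsto (fun s => eLpNorm (slice (c • F) s - c • a) 2 angle) l (𝓝 0) := by
  have key : ∀ s, eLpNorm (slice (c • F) s - c • a) 2 angle =
      ‖c‖ₑ * eLpNorm (slice F s - a) 2 angle := fun s => by
    rw [← eLpNorm_const_smul, smul_sub]; rfl
  simp only [key]
  simpa using ENNReal.Tendsto.const_mul (a := ‖c‖ₑ) h (Or.inr enorm_ne_top)

/-- The Hardy space `H²_α` of the annulus `q < |z| < 1` as a subspace of `L²(B)`: the boundary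
functions of the analytic, modulus automorphic functions of index `α` with bounded `L²` means. -/
def hardySpace {q : ℝ} (hq : q ∈ Ioo (0 : ℝ) 1) (α : ℝ) :
    Submodule ℂ (Lp ℂ 2 (boundaryMeasure q)) where
  carrier := {g | ∃ F, IsHardy q α F ∧ HasBoundaryValue q F g}
  zero_mem' := by
    have h2 : ∀ s : ℝ, slice 0 s = 0 := fun s => by funext t; simp [slice]
    refine ⟨0, ⟨differentiableOn_const 0, fun w _ => by simp, 0, fun s _ => by simp [h2]⟩,
      HasBoundaryValue.congr (g := 0) ⟨?_, ?_⟩ (Lp.coeFn_zero ℂ 2 (boundaryMeasure q)).symm⟩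
    · simp [h2]
    · simp [h2]
  add_mem' := by
    rintro g h ⟨F, hF, hFg⟩ ⟨G, hG, hGh⟩
    refine ⟨F + G, hF.add hG,
      HasBoundaryValue.congr (g := (g : ℂ → ℂ) + h) ⟨?_, ?_⟩ (Lp.coeFn_add g h).symm⟩
    · exact tendsto_add_aux (eventually_outer hq hF.analytic) (eventually_outer hq hG.analytic)
        ((Lp.aestronglyMeasurable g).comp_quasiMeasurePreserving (quasi_one q))
        ((Lp.aestronglyMeasurable h).comp_quasiMeasurePreserving (quasi_one q))
        hFg.outer_circle hGh.outer_circle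
    · exact tendsto_add_aux (eventually_inner hq hF.analytic) (eventually_inner hq hG.analytic)
        ((Lp.aestronglyMeasurable g).comp_quasiMeasurePreserving (quasi_q q))
        ((Lp.aestronglyMeasurable h).comp_quasiMeasurePreserving (quasi_q q))
        hFg.inner_circle hGh.inner_circle
  smul_mem' := by
    rintro c g ⟨F, hF, hFg⟩
    exact ⟨c • F, hF.smul c, HasBoundaryValue.congr (g := c • (g : ℂ → ℂ))
      ⟨tendsto_smul_aux c hFg.outer_circle, tendsto_smul_aux c hFg.inner_circle⟩
      (Lp.coeFn_smul c g).symm⟩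

/-- The Toeplitz operator `T_φ^α g = P_α (φ g)` on `H²_α`, with real symbol `φ ∈ L^∞(B)`, where `P_α`
is the orthogonal projection of `L²(B)` onto `H²_α`. (`H²_α` is a closed subspace; its closure is
written here, which does not change it, because Mathlib projects onto complete subspaces.) -/
def toeplitz {q : ℝ} (hq : q ∈ Ioo (0 : ℝ) 1) (α : ℝ) (φ : Lp ℝ ∞ (boundaryMeasure q))
    (g : hardySpace hq α) : Lp ℂ 2 (boundaryMeasure q) :=
  (hardySpace hq α).topologicalClosure.starProjection
    (φ • (g : Lp ℂ 2 (boundaryMeasure q)) : Lp ℂ 2 (boundaryMeasure q))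

/-- The set of eigenvalues of `φ` relative to the annulus algebra: those `c` for which there are an
`α ∈ [0, 1)` and a nonzero `g ∈ H²_α` with `T_φ^α g = c g`. -/
def relativeEigenvalues {q : ℝ} (hq : q ∈ Ioo (0 : ℝ) 1) (φ : Lp ℝ ∞ (boundaryMeasure q)) : Set ℂ :=
  {c | ∃ α ∈ Ico (0 : ℝ) 1, ∃ g : hardySpace hq α, g ≠ 0 ∧
    toeplitz hq α φ g = c • (g : Lp ℂ 2 (boundaryMeasure q))}

end AnnulusToeplitz

end

/-!
In the covering coordinate `w = s + i t` the boundary functions in `H²_α` are the pairs of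
functions on the two circles whose Fourier coefficients at the frequencies `k + α` come from one
Laurent series `∑ₖ xₖ z ^ (k + α)`.

*Necessity.* If `T_φ g = l g` with `l` real, then `(φ - l) |g|²` annihilates all `z ^ n`; being real
it is a constant `d` on the outer circle and `-d` on the inner one. If `d ≠ 0`, then `l` strictly
separates the values of `φ` on one circle from those on the other. If `d = 0`, then `φ = l` wherever
`g ≠ 0`, and since a product of two Hardy functions vanishes on the outer circle only if one of them
is zero, this happens for at most one `l`. Comparing signs, a number strictly between two
eigenvalues separates the values of `φ` on the two circles by a positive distance.

*Sufficiency.* For such an `l` the absolute value of `φ - l` is a weight bounded above and below, so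
the projection onto the outer circle, compressed to the weighted `H²_0`, is a positive contraction
`a`. As monomials live essentially on one of the circles, `a - a²` is compact, and it is nonzero, so
`a` has an eigenvalue `μ ∈ (0, 1)`. Multiplying its eigenvector by `z ^ α` with
`q ^ (2α) = μ / (1 - μ)` gives an eigenfunction for `l` of index `α`.
-/

noncomputable section

namespace AnnulusToeplitz

section Fourier

instance : IsFiniteMeasure angle := by unfold angle; infer_instance

instance : NeZero angle := ⟨by simp [angle, Real.pi_pos]⟩

instance fact_two_pi_pos : Fact (0 < 2 * Real.pi) := ⟨Real.two_pi_pos⟩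

theorem integral_angle {E : Type*} [NormedAddCommGroup E] [NormedSpace ℝ E] (f : ℝ → E) :
    ∫ t, f t ∂angle = ∫ t in -Real.pi..Real.pi, f t :=
  (intervalIntegral.integral_of_le (neg_le_self Real.pi_pos.le)).symm

/-- The character `t ↦ e^{ibt}` of the real line. -/
def expChar (b t : ℝ) : ℂ := Complex.exp ((b * t : ℝ) * Complex.I)

theorem continuous_expChar (b : ℝ) : Continuous (expChar b) := by unfold expChar; fun_prop

@[simp] theorem norm_expChar (b t : ℝ) : ‖expChar b t‖ = 1 := Complex.norm_exp_ofReal_mul_I _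

@[simp] theorem expChar_zero (t : ℝ) : expChar 0 t = 1 := by simp [expChar]

theorem expChar_add (a b t : ℝ) : expChar (a + b) t = expChar a t * expChar b t := by
  unfold expChar
  rw [← Complex.exp_add]
  push_cast
  ring_nf

theorem expChar_neg (b t : ℝ) : expChar (-b) t = starRingEnd ℂ (expChar b t) := by
  unfold expChar
  rw [← Complex.exp_conj]
  simp

theorem expChar_mul_expChar_neg (b t : ℝ) : expChar b t * expChar (-b) t = 1 := by
  rw [← expChar_add, add_neg_cancel, expChar_zero]

theorem fourier_coe_eq_expChar (n : ℤ) (t : ℝ) :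
    fourier n (t : AddCircle (2 * Real.pi)) = expChar n t := by
  rw [fourier_coe_apply, expChar]
  congr 1
  push_cast
  field [Real.pi_ne_zero]

/-- The normalized Fourier coefficient `(2π)⁻¹ ∫ f(t) e^{-ibt} dt` over one period. The frequency
`b` is real, because functions of index `α` have frequencies in `ℤ + α`. -/
def fourierCoef (b : ℝ) (f : ℝ → ℂ) : ℂ := (2 * Real.pi)⁻¹ • ∫ t, f t * expChar (-b) t ∂angle

theorem fourierCoef_congr {f g : ℝ → ℂ} (h : f =ᵐ[angle] g) (b : ℝ) :
    fourierCoef b f = fourierCoef b g := by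
  unfold fourierCoef
  exact congrArg _ (integral_congr_ae (h.mul .rfl))

theorem fourierCoef_mul_expChar (a b : ℝ) (f : ℝ → ℂ) :
    fourierCoef (b + a) (f * expChar a) = fourierCoef b f := by
  unfold fourierCoef
  congr 2
  funext t
  rw [neg_add, expChar_add, Pi.mul_apply]
  linear_combination f t * expChar (-b) t * expChar_mul_expChar_neg a t

theorem fourierCoef_add_right (a b : ℝ) (f : ℝ → ℂ) :
    fourierCoef (b + a) f = fourierCoef b (f * expChar (-a)) := by
  rw [← fourierCoef_mul_expChar (-a), add_neg_cancel_right]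

theorem fourierCoef_smul (c : ℂ) (b : ℝ) (f : ℝ → ℂ) :
    fourierCoef b (c • f) = c * fourierCoef b f := by
  simp only [fourierCoef, Pi.smul_apply, smul_eq_mul, mul_assoc, integral_const_mul,
    mul_smul_comm]

theorem fourierCoef_sub {f g : ℝ → ℂ} (hf : Integrable f angle) (hg : Integrable g angle) (b : ℝ) :
    fourierCoef b (f - g) = fourierCoef b f - fourierCoef b g := by
  have hint {h : ℝ → ℂ} (hh : Integrable h angle) :
      Integrable (fun t => h t * expChar (-b) t) angle :=
    hh.mul_bdd (c := 1) (continuous_expChar _).aestronglyMeasurable (by simp)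
  simp only [fourierCoef, Pi.sub_apply, sub_mul, integral_sub (hint hf) (hint hg), smul_sub]

theorem norm_fourierCoef_le (b : ℝ) (f : ℝ → ℂ) :
    ‖fourierCoef b f‖ ≤ (2 * Real.pi)⁻¹ * ∫ t, ‖f t‖ ∂angle := by
  rw [fourierCoef, norm_smul, Real.norm_of_nonneg (by positivity)]
  gcongr
  exact (norm_integral_le_integral_norm _).trans_eq (by simp)

theorem fourierCoef_int_eq_fourierCoeffOn (f : ℝ → ℂ) (n : ℤ) :
    fourierCoef n f = fourierCoeffOn (neg_lt_self Real.pi_pos) f n := by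
  have h2π : Real.pi - -Real.pi = 2 * Real.pi := by ring
  rw [fourierCoeffOn_eq_integral, h2π, fourierCoef, integral_angle, one_div]
  simp only [fourier_coe_eq_expChar, smul_eq_mul, mul_comm, Int.cast_neg]

theorem fourierCoef_expChar (k n : ℤ) (a : ℝ) :
    fourierCoef (k + a) (expChar (n + a)) = Pi.single (M := fun _ => ℂ) n 1 k := by
  have h : expChar (n + a) * expChar (-a) =
      fun t : ℝ => fourier n (t : AddCircle (2 * Real.pi)) := by
    funext t
    rw [Pi.mul_apply, ← expChar_add, add_neg_cancel_right, fourier_coe_eq_expChar]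
  have h2π : -Real.pi + 2 * Real.pi = Real.pi := by ring
  rw [fourierCoef_add_right, h, ← fourierCoeff_fourier (T := 2 * Real.pi),
    fourierCoeff_eq_intervalIntegral _ _ (-Real.pi), h2π, fourierCoef, integral_angle, one_div]
  simp only [fourier_coe_eq_expChar, smul_eq_mul, mul_comm, Int.cast_neg]

theorem fourierCoef_tsum {c : ℤ → ℂ} (hc : Summable c) (a : ℝ) (k : ℤ) :
    fourierCoef (k + a) (fun t => ∑' j : ℤ, c j * expChar (j + a) t) = c k := by
  have hcont (j : ℤ) : Continuous fun t => c j * expChar (j + a) t * expChar (-(k + a)) t :=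
    (continuous_const.mul (continuous_expChar _)).mul (continuous_expChar _)
  have hnorm (j : ℤ) (t : ℝ) : ‖c j * expChar (j + a) t * expChar (-(k + a)) t‖ = ‖c j‖ := by simp
  have h := hasSum_integral_of_summable_integral_norm (μ := angle)
    (fun j => .of_bound (hcont j).aestronglyMeasurable _ (.of_forall fun t => (hnorm j t).le)) (by
      simpa only [hnorm, integral_const] using hc.norm.const_smul (angle.real univ))
  simp only [tsum_mul_right] at h
  have hcoef := h.const_smul (2 * Real.pi)⁻¹
  have hterm (j : ℤ) : (2 * Real.pi)⁻¹ • ∫ t, c j * expChar (j + a) t * expChar (-(k + a)) t ∂angle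
      = c j * Pi.single (M := fun _ => ℂ) j 1 k := by
    rw [← fourierCoef_expChar, ← fourierCoef_smul]
    rfl
  simp only [hterm] at hcoef
  rw [fourierCoef, ← hcoef.tsum_eq, tsum_eq_single k fun j hj => by
    rw [Pi.single_eq_of_ne hj.symm, mul_zero], Pi.single_eq_same, mul_one]

theorem hasSum_sq_fourierCoef {f : ℝ → ℂ} (hf : MemLp f 2 angle) (a : ℝ) :
    HasSum (fun k : ℤ => ‖fourierCoef (k + a) f‖ ^ 2)
      ((2 * Real.pi)⁻¹ * ∫ t, ‖f t‖ ^ 2 ∂angle) := by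
  have hf' : MemLp (f * expChar (-a)) 2 angle :=
    hf.of_le (hf.1.mul (continuous_expChar _).aestronglyMeasurable) (by simp)
  have h := hasSum_sq_fourierCoeffOn (neg_lt_self Real.pi_pos) hf'
  have h2π : Real.pi - -Real.pi = 2 * Real.pi := by ring
  simpa only [← fourierCoef_int_eq_fourierCoeffOn, ← fourierCoef_add_right, ← integral_angle,
    Pi.mul_apply, norm_mul, norm_expChar, mul_one, smul_eq_mul, h2π] using h

theorem eLpNorm_two_eq_sqrt_integral {X E : Type*} [MeasurableSpace X] [NormedAddCommGroup E]
    {μ : Measure X} {f : X → E} (hf : MemLp f 2 μ) :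
    eLpNorm f 2 μ = ENNReal.ofReal √(∫ t, ‖f t‖ ^ 2 ∂μ) := by
  rw [hf.eLpNorm_eq_integral_rpow_norm two_ne_zero ENNReal.ofNat_ne_top]
  simp [Real.sqrt_eq_rpow]

theorem eLpNorm_eq_sqrt_tsum_fourierCoef {f : ℝ → ℂ} (hf : MemLp f 2 angle) (a : ℝ) :
    eLpNorm f 2 angle =
      ENNReal.ofReal √(2 * Real.pi * ∑' k : ℤ, ‖fourierCoef (k + a) f‖ ^ 2) := by
  rw [eLpNorm_two_eq_sqrt_integral hf, (hasSum_sq_fourierCoef hf a).tsum_eq,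
    mul_inv_cancel_left₀ Real.two_pi_pos.ne']

theorem ae_eq_zero_of_fourierCoef_eq_zero {f : ℝ → ℂ} (hf : MemLp f 2 angle) (a : ℝ)
    (h : ∀ k : ℤ, fourierCoef (k + a) f = 0) : f =ᵐ[angle] 0 := by
  rw [← eLpNorm_eq_zero_iff hf.1 two_ne_zero, eLpNorm_eq_sqrt_tsum_fourierCoef hf a]
  simp [h]

theorem tendsto_eLpNorm_one_of_two {X ι E : Type*} [MeasurableSpace X] [NormedAddCommGroup E]
    {μ : Measure X} [IsFiniteMeasure μ] {l : Filter ι} {f : ι → X → E}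
    (hf : ∀ᶠ i in l, AEStronglyMeasurable (f i) μ)
    (h : Tendsto (fun i => eLpNorm (f i) 2 μ) l (𝓝 0)) :
    Tendsto (fun i => eLpNorm (f i) 1 μ) l (𝓝 0) := by
  have hC := ENNReal.Tendsto.mul_const
    (b := μ univ ^ (1 / (1 : ℝ≥0∞).toReal - 1 / (2 : ℝ≥0∞).toReal)) h
    (Or.inr (ENNReal.rpow_ne_top_of_nonneg (by norm_num) (measure_ne_top _ _)))
  rw [zero_mul] at hC
  refine tendsto_of_tendsto_of_tendsto_of_le_of_le' tendsto_const_nhds hC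
    (.of_forall fun _ => zero_le) ?_
  filter_upwards [hf] with i hi
  exact eLpNorm_le_eLpNorm_mul_rpow_measure_univ one_le_two hi

theorem tendsto_fourierCoef {ι : Type*} {l : Filter ι} {f : ι → ℝ → ℂ} {g : ℝ → ℂ}
    (hf : ∀ᶠ i in l, Integrable (f i) angle) (hg : Integrable g angle)
    (h : Tendsto (fun i => eLpNorm (f i - g) 1 angle) l (𝓝 0)) (b : ℝ) :
    Tendsto (fun i => fourierCoef b (f i)) l (𝓝 (fourierCoef b g)) := by
  rw [tendsto_iff_norm_sub_tendsto_zero]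
  have hbound :
      Tendsto (fun i => (2 * Real.pi)⁻¹ * (eLpNorm (f i - g) 1 angle).toReal) l (𝓝 0) := by
    simpa using (((ENNReal.tendsto_toReal ENNReal.zero_ne_top).comp h).const_mul (2 * Real.pi)⁻¹)
  refine squeeze_zero' (.of_forall fun _ => norm_nonneg _) ?_ hbound
  filter_upwards [hf] with i hi
  rw [← fourierCoef_sub hi hg, eLpNorm_one_eq_lintegral_enorm,
    ← integral_norm_eq_lintegral_enorm (hi.sub hg).1]
  exact norm_fourierCoef_le _ _

theorem tendsto_fourierCoef_of_eLpNorm_two {ι : Type*} {l : Filter ι} {f : ι → ℝ → ℂ} {g : ℝ → ℂ}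
    (hf : ∀ᶠ i in l, MemLp (f i) 2 angle) (hg : MemLp g 2 angle)
    (h : Tendsto (fun i => eLpNorm (f i - g) 2 angle) l (𝓝 0)) (b : ℝ) :
    Tendsto (fun i => fourierCoef b (f i)) l (𝓝 (fourierCoef b g)) :=
  tendsto_fourierCoef (hf.mono fun _ hi => hi.integrable one_le_two) (hg.integrable one_le_two)
    (tendsto_eLpNorm_one_of_two (hf.mono fun _ hi => (hi.sub hg).1) h) b

theorem integral_continuousMap_mul_eq_zero {f : ℝ → ℂ} (hf : Integrable f angle)
    (h : ∀ k : ℤ, fourierCoef k f = 0) (g : C(AddCircle (2 * Real.pi), ℂ)) :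
    ∫ t, g (t : AddCircle (2 * Real.pi)) * f t ∂angle = 0 := by
  have hint (g : C(AddCircle (2 * Real.pi), ℂ)) :
      Integrable (fun t : ℝ => g (t : AddCircle (2 * Real.pi)) * f t) angle :=
    hf.bdd_mul (c := ‖g‖) (g.continuous.comp (AddCircle.continuous_mk' _)).aestronglyMeasurable
      (.of_forall fun t => g.norm_coe_le_norm _)
  let Λ : C(AddCircle (2 * Real.pi), ℂ) →L[ℂ] ℂ := LinearMap.mkContinuous
    { toFun g := ∫ t, g (t : AddCircle (2 * Real.pi)) * f t ∂angle
      map_add' g₁ g₂ := by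
        simp only [ContinuousMap.add_apply, add_mul, integral_add (hint g₁) (hint g₂)]
      map_smul' c g := by
        simp only [ContinuousMap.smul_apply, smul_eq_mul, mul_assoc, RingHom.id_apply,
          integral_const_mul] }
    (∫ t, ‖f t‖ ∂angle) fun g => by
      refine (norm_integral_le_integral_norm _).trans ?_
      rw [mul_comm (∫ t, ‖f t‖ ∂angle), ← integral_const_mul]
      refine integral_mono (hint g).norm (hf.norm.const_mul _) fun t => ?_
      simp only [norm_mul]
      gcongr
      exact g.norm_coe_le_norm _
  have hdense := Submodule.dense_iff_topologicalClosure_eq_top.2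
    (span_fourier_closure_eq_top (T := 2 * Real.pi))
  suffices Λ = 0 from congr($this g)
  refine ContinuousLinearMap.ext_on hdense ?_
  rintro _ ⟨n, rfl⟩
  change ∫ t, fourier n (t : AddCircle (2 * Real.pi)) * f t ∂angle = 0
  have hn := h (-n)
  rw [fourierCoef, smul_eq_zero_iff_right (inv_ne_zero Real.two_pi_pos.ne')] at hn
  simpa only [fourier_coe_eq_expChar, mul_comm, Int.cast_neg, neg_neg] using hn

theorem ae_eq_zero_of_fourierCoef_int_eq_zero {f : ℝ → ℂ} (hf : Integrable f angle)
    (h : ∀ k : ℤ, fourierCoef k f = 0) : f =ᵐ[angle] 0 := by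
  have hf' : IntegrableOn f (Ioo (-Real.pi) Real.pi) := hf.mono_measure <|
    Measure.restrict_mono Ioo_subset_Ioc_self le_rfl
  suffices ∀ᵐ t, t ∈ Ioo (-Real.pi) Real.pi → f t = 0 by
    rwa [angle, ← restrict_Ioo_eq_restrict_Ioc, EventuallyEq, ae_restrict_iff' measurableSet_Ioo]
  refine isOpen_Ioo.ae_eq_zero_of_integral_contDiff_smul_eq_zero hf'.locallyIntegrableOn
    fun g hg _ hgs => ?_
  have hg0 {x : ℝ} (hx : x ∉ Ioo (-Real.pi) Real.pi) : g x = 0 :=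
    image_eq_zero_of_notMem_tsupport fun hx' => hx (hgs hx')
  let G : C(AddCircle (2 * Real.pi), ℂ) :=
    ⟨AddCircle.liftIco (2 * Real.pi) (-Real.pi) (fun x => (g x : ℂ)),
      AddCircle.liftIco_continuous
        (by rw [hg0 (by simp), hg0 (by rw [mem_Ioo]; intro h; linarith [h.2])])
        (Complex.continuous_ofReal.comp hg.continuous).continuousOn⟩
  have hG {t : ℝ} (ht : t ∈ Ioo (-Real.pi) Real.pi) : G t = (g t : ℂ) :=
    AddCircle.liftIco_coe_apply (f := fun x => (g x : ℂ)) ⟨ht.1.le, by linarith [ht.2]⟩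
  rw [← setIntegral_eq_integral_of_forall_compl_eq_zero (s := Ioo (-Real.pi) Real.pi)
    (fun x hx => by rw [hg0 hx, zero_smul]), ← integral_continuousMap_mul_eq_zero hf h G, angle,
    integral_Ioc_eq_integral_Ioo]
  exact setIntegral_congr_fun measurableSet_Ioo fun t ht => by simp only [hG ht, Complex.real_smul]

end Fourier

section Boundary

theorem norm_circ {ρ : ℝ} (hρ : 0 ≤ ρ) (t : ℝ) : ‖circ ρ t‖ = ρ := by
  rw [circ, norm_mul, Complex.norm_exp_ofReal_mul_I, mul_one, Complex.norm_of_nonneg hρ]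

theorem circ_ne_zero {ρ : ℝ} (hρ : 0 < ρ) (t : ℝ) : circ ρ t ≠ 0 :=
  norm_ne_zero_iff.1 ((norm_circ hρ.le t).trans_ne hρ.ne')

theorem arg_circ {ρ t : ℝ} (hρ : 0 < ρ) (ht : t ∈ Ioc (-Real.pi) Real.pi) :
    (circ ρ t).arg = t := by
  rw [circ, Complex.exp_mul_I, Complex.arg_mul_cos_add_sin_mul_I hρ ht]

theorem ae_circleMeasure_iff {ρ : ℝ} (hρ : 0 < ρ) {P : ℂ → Prop} :
    (∀ᵐ z ∂circleMeasure ρ, P z) ↔ ∀ᵐ t ∂angle, P (circ ρ t) := by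
  have hval : MeasurableEmbedding ((↑) : Ioc (-Real.pi) Real.pi → ℝ) :=
    .subtype_coe measurableSet_Ioc
  have := (measurableSet_Ioc (a := -Real.pi) (b := Real.pi)).standardBorel
  have hcirc : MeasurableEmbedding (circ ρ ∘ ((↑) : Ioc (-Real.pi) Real.pi → ℝ)) := by
    refine ((measurable_circ ρ).comp measurable_subtype_coe).measurableEmbedding fun s t hst => ?_
    rw [Subtype.ext_iff, ← arg_circ hρ s.2, ← arg_circ hρ t.2]
    exact congrArg Complex.arg hst
  have hangle : angle = (volume.comap Subtype.val).map (Subtype.val : Ioc (-Real.pi) Real.pi → ℝ) :=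
    (map_comap_subtype_coe measurableSet_Ioc volume).symm
  rw [circleMeasure, hangle, Measure.map_map (measurable_circ ρ) measurable_subtype_coe,
    hcirc.ae_map_iff, hval.ae_map_iff]
  rfl

theorem ae_boundaryMeasure_iff {q : ℝ} (hq : 0 < q) {P : ℂ → Prop} :
    (∀ᵐ z ∂boundaryMeasure q, P z) ↔
      (∀ᵐ t ∂angle, P (circ 1 t)) ∧ ∀ᵐ t ∂angle, P (circ q t) := by
  rw [boundaryMeasure, ae_add_measure_iff, ae_circleMeasure_iff one_pos, ae_circleMeasure_iff hq]

instance (ρ : ℝ) : IsFiniteMeasure (circleMeasure ρ) := by unfold circleMeasure; infer_instance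

instance (q : ℝ) : IsFiniteMeasure (boundaryMeasure q) := by unfold boundaryMeasure; infer_instance

theorem circleMeasure_one_le (q : ℝ) : circleMeasure 1 ≤ boundaryMeasure q :=
  Measure.le_add_right le_rfl

theorem circleMeasure_inner_le (q : ℝ) : circleMeasure q ≤ boundaryMeasure q :=
  Measure.le_add_left le_rfl

theorem memLp_comp_circ {E : Type*} [NormedAddCommGroup E] {ρ : ℝ} {ν : Measure ℂ}
    (hρ : circleMeasure ρ ≤ ν) {p : ℝ≥0∞} {f : ℂ → E} (hf : MemLp f p ν) :
    MemLp (f ∘ circ ρ) p angle :=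
  (hf.mono_measure hρ).comp_of_map (measurable_circ ρ).aemeasurable

theorem integral_boundaryMeasure {E : Type*} [NormedAddCommGroup E] [NormedSpace ℝ E] {q : ℝ}
    {f : ℂ → E} (hf : Integrable f (boundaryMeasure q)) :
    ∫ z, f z ∂boundaryMeasure q = ∫ t, f (circ 1 t) ∂angle + ∫ t, f (circ q t) ∂angle := by
  have hf₁ := hf.mono_measure (circleMeasure_one_le q)
  have hf₂ := hf.mono_measure (circleMeasure_inner_le q)
  rw [boundaryMeasure, integral_add_measure hf₁ hf₂, circleMeasure, circleMeasure,
    integral_map (measurable_circ _).aemeasurable hf₁.1,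
    integral_map (measurable_circ _).aemeasurable hf₂.1]

end Boundary

section Slices

theorem mem_cover_add_mul_I {q s : ℝ} (hs : s ∈ Ioo (Real.log q) 0) (t : ℝ) :
    (s : ℂ) + t * Complex.I ∈ cover q := by
  simpa [cover] using hs

theorem memLp_slice {q : ℝ} {F : ℂ → ℂ} (hF : DifferentiableOn ℂ F (cover q)) {s : ℝ}
    (hs : s ∈ Ioo (Real.log q) 0) (p : ℝ≥0∞) : MemLp (slice F s) p angle := by
  have hc := continuous_slice hF hs
  obtain ⟨C, hC⟩ := (isCompact_Icc (a := -Real.pi) (b := Real.pi)).exists_bound_of_continuousOn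
    hc.continuousOn
  exact .of_bound hc.aestronglyMeasurable C <|
    (ae_restrict_mem measurableSet_Ioc).mono fun t ht => hC t (Ioc_subset_Icc_self ht)

theorem integral_slice_eq_of_periodic {q : ℝ} {G : ℂ → ℂ} (hG : DifferentiableOn ℂ G (cover q))
    (hper : ∀ w ∈ cover q, G (w + 2 * Real.pi * Complex.I) = G w) {s₁ s₂ : ℝ}
    (h₁ : s₁ ∈ Ioo (Real.log q) 0) (h₂ : s₂ ∈ Ioo (Real.log q) 0) :
    ∫ t, slice G s₁ t ∂angle = ∫ t, slice G s₂ t ∂angle := by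
  have hcauchy := Complex.integral_boundary_rect_eq_zero_of_differentiableOn G
    ⟨s₁, -Real.pi⟩ ⟨s₂, Real.pi⟩ <| hG.mono fun w hw =>
      ordConnected_Ioo.uIcc_subset h₁ h₂ (Complex.mem_reProdIm.1 hw).1
  have hsides : ∫ x in s₁..s₂, G (x + (Real.pi : ℝ) * Complex.I) =
      ∫ x in s₁..s₂, G (x + (-Real.pi : ℝ) * Complex.I) := by
    refine intervalIntegral.integral_congr fun x hx => ?_
    rw [← hper _ (mem_cover_add_mul_I (ordConnected_Ioo.uIcc_subset h₁ h₂ hx) (-Real.pi))]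
    congr 1
    push_cast
    ring
  simp only [hsides, sub_self, zero_add, ← smul_sub] at hcauchy
  rw [smul_eq_zero_iff_right Complex.I_ne_zero, sub_eq_zero] at hcauchy
  rw [integral_angle, integral_angle]
  exact hcauchy.symm

/-- `F` is an analytic, modulus automorphic function of index `α` on the covering surface, with no
condition on its means. -/
structure IsAutomorphic (q α : ℝ) (F : ℂ → ℂ) : Prop where
  analytic : DifferentiableOn ℂ F (cover q)
  index : ∀ w ∈ cover q, F (w + 2 * Real.pi * Complex.I) =
    Complex.exp (2 * Real.pi * Complex.I * α) * F w

theorem IsHardy.isAutomorphic {q α : ℝ} {F : ℂ → ℂ} (hF : IsHardy q α F) : IsAutomorphic q α F :=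
  ⟨hF.analytic, hF.index⟩

variable {q α : ℝ} {F : ℂ → ℂ}

theorem exp_mul_fourierCoef_slice_eq (hF : IsAutomorphic q α F) (k : ℤ) {s₁ s₂ : ℝ}
    (h₁ : s₁ ∈ Ioo (Real.log q) 0) (h₂ : s₂ ∈ Ioo (Real.log q) 0) :
    Real.exp (-((k + α) * s₁)) * fourierCoef (k + α) (slice F s₁) =
      Real.exp (-((k + α) * s₂)) * fourierCoef (k + α) (slice F s₂) := by
  let G : ℂ → ℂ := fun w => F w * Complex.exp (-((k + α : ℝ) * w))
  have hper (w) (hw : w ∈ cover q) : G (w + 2 * Real.pi * Complex.I) = G w := by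
    simp only [G, hF.index w hw]
    rw [mul_right_comm, mul_comm, ← Complex.exp_add]
    congr 1
    rw [Complex.exp_eq_exp_iff_exists_int]
    exact ⟨-k, by push_cast; ring⟩
  have hcoef (s : ℝ) : Real.exp (-((k + α) * s)) * fourierCoef (k + α) (slice F s) =
      (2 * Real.pi)⁻¹ • ∫ t, slice G s t ∂angle := by
    rw [fourierCoef, mul_smul_comm, ← integral_const_mul]
    congr 2
    funext t
    simp only [slice, G, expChar]
    rw [mul_left_comm]
    push_cast
    rw [← Complex.exp_add]
    ring_nf
  have hG : DifferentiableOn ℂ G (cover q) := hF.analytic.mul (by fun_prop)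
  rw [hcoef, hcoef, integral_slice_eq_of_periodic hG hper h₁ h₂]

theorem fourierCoef_slice_of_tendsto (hF : IsAutomorphic q α F) {u : ℝ → ℂ}
    (hu : Integrable u angle) {l : Filter ℝ} [l.NeBot] {s₀ : ℝ} (hl : l ≤ 𝓝 s₀)
    (hmem : ∀ᶠ s in l, s ∈ Ioo (Real.log q) 0)
    (hlim : Tendsto (fun s => eLpNorm (slice F s - u) 1 angle) l (𝓝 0)) (k : ℤ) {s : ℝ}
    (hs : s ∈ Ioo (Real.log q) 0) :
    Real.exp (-((k + α) * s)) * fourierCoef (k + α) (slice F s) =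
      Real.exp (-((k + α) * s₀)) * fourierCoef (k + α) u := by
  have hexp : Continuous fun s : ℝ => (Real.exp (-((k + α) * s)) : ℂ) := by fun_prop
  have hint : ∀ᶠ s in l, Integrable (slice F s) angle :=
    hmem.mono fun s hs => memLp_one_iff_integrable.1 (memLp_slice hF.analytic hs 1)
  have hcoef := tendsto_fourierCoef hint hu hlim (k + α)
  refine tendsto_nhds_unique (tendsto_const_nhds.congr' ?_)
    (((hexp.tendsto s₀).mono_left hl).mul hcoef)
  exact hmem.mono fun s' hs' => exp_mul_fourierCoef_slice_eq hF k hs hs'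

/-- The relation between the Fourier coefficients of `g` on the two boundary circles which says that
both are those of one Laurent series `∑ₖ xₖ z^(k+α)`, as `exp ((k + α) log q) = q ^ (k + α)`. -/
def LaurentRelation (q α : ℝ) (g : ℂ → ℂ) : Prop :=
  ∀ k : ℤ, fourierCoef (k + α) (g ∘ circ q) =
    Real.exp ((k + α) * Real.log q) * fourierCoef (k + α) (g ∘ circ 1)

theorem HasBoundaryValue.laurentRelation (hq : q ∈ Ioo 0 1) {g : ℂ → ℂ}
    (hF : IsAutomorphic q α F) (hg : MemLp g 2 (boundaryMeasure q)) (hFg : HasBoundaryValue q F g) :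
    LaurentRelation q α g := by
  intro k
  have hlog := Real.log_neg hq.1 hq.2
  obtain ⟨s, hs⟩ := nonempty_Ioo.2 hlog
  have hcoef {ρ s₀ : ℝ} {l : Filter ℝ} [l.NeBot] (hρ : circleMeasure ρ ≤ boundaryMeasure q)
      (hl : l ≤ 𝓝 s₀) (hmem : Ioo (Real.log q) 0 ∈ l)
      (hlim : Tendsto (fun s => eLpNorm (slice F s - g ∘ circ ρ) 2 angle) l (𝓝 0)) :
      Real.exp (-((k + α) * s)) * fourierCoef (k + α) (slice F s) =
        Real.exp (-((k + α) * s₀)) * fourierCoef (k + α) (g ∘ circ ρ) :=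
    have hgρ := memLp_comp_circ hρ hg
    fourierCoef_slice_of_tendsto hF (hgρ.integrable one_le_two) hl hmem
      (tendsto_eLpNorm_one_of_two
        (mem_of_superset hmem fun s hs => ((memLp_slice hF.analytic hs 2).sub hgρ).1) hlim) k hs
  have houter := hcoef (circleMeasure_one_le q) nhdsWithin_le_nhds (Ioo_mem_nhdsLT hlog)
    hFg.outer_circle
  have hinner := hcoef (circleMeasure_inner_le q) nhdsWithin_le_nhds (Ioo_mem_nhdsGT hlog)
    hFg.inner_circle
  rw [hinner] at houter
  simp only [mul_zero, neg_zero, Real.exp_zero, Complex.ofReal_one, one_mul] at houter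
  rw [← houter, ← mul_assoc, ← Complex.ofReal_mul, ← Real.exp_add, add_neg_cancel, Real.exp_zero,
    Complex.ofReal_one, one_mul]

end Slices

section LaurentSeries

theorem summable_exp_neg_mul_abs_add {δ : ℝ} (hδ : 0 < δ) (a : ℝ) :
    Summable fun k : ℤ => Real.exp (-(δ * |k + a|)) := by
  have hgeom : Summable fun k : ℤ => Real.exp (-δ) ^ k.natAbs := by
    have h := summable_geometric_of_lt_one (Real.exp_pos (-δ)).le
      (Real.exp_lt_one_iff.2 (neg_lt_zero.2 hδ))
    exact .of_nat_of_neg (by simpa using h) (by simpa using h)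
  refine (hgeom.mul_left (Real.exp (δ * |a|))).of_nonneg_of_le (fun _ => (Real.exp_pos _).le)
    fun k => ?_
  have habs : |(k : ℝ)| ≤ |k + a| + |a| := by simpa using abs_sub (k + a : ℝ) a
  rw [← Real.exp_nat_mul, ← Real.exp_add, Real.exp_le_exp, Nat.cast_natAbs, Int.cast_abs]
  nlinarith

theorem exp_mul_le_exp_neg_mul_abs {L δ s : ℝ} (hs : s ∈ Icc (L + δ) (-δ)) (b : ℝ) :
    Real.exp (b * s) ≤ Real.exp (-(δ * |b|)) * (1 + Real.exp (b * L)) := by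
  rw [mul_add, mul_one, ← Real.exp_add]
  rcases le_total 0 b with hb | hb
  · refine le_add_of_le_of_nonneg (Real.exp_le_exp.2 ?_) (Real.exp_pos _).le
    rw [abs_of_nonneg hb]
    nlinarith [hs.2]
  · refine le_add_of_nonneg_of_le (Real.exp_pos _).le (Real.exp_le_exp.2 ?_)
    rw [abs_of_nonpos hb]
    nlinarith [hs.1]

theorem exp_mul_le_one_add_exp_mul {L s : ℝ} (hs : s ∈ Icc L 0) (b : ℝ) :
    Real.exp (b * s) ≤ 1 + Real.exp (b * L) := by
  simpa using exp_mul_le_exp_neg_mul_abs (δ := 0) (L := L) (s := s) (by simpa using hs) b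

theorem exists_mem_Ioo_shrink {L s : ℝ} (hs : s ∈ Ioo L 0) :
    ∃ δ > 0, s ∈ Ioo (L + δ) (-δ) := by
  obtain ⟨δ, hδ, hδs⟩ := exists_between (lt_min (sub_pos.2 hs.1) (neg_pos.2 hs.2))
  exact ⟨δ, hδ, by linarith [hδs.trans_le (min_le_left _ _)],
    by linarith [hδs.trans_le (min_le_right _ _)]⟩

/-- The Laurent series `∑ₖ xₖ z^(k+α)` on the covering surface, where `z = exp w`. -/
def laurentSeries (α : ℝ) (x : ℤ → ℂ) (w : ℂ) : ℂ := ∑' k : ℤ, x k * Complex.exp ((k + α : ℝ) * w)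

/-- Square summability of the coefficients of `∑ₖ xₖ z^(k+α)` over both circles of the boundary,
where they are `xₖ` and `xₖ exp ((k + α) log q)`. -/
def IsSquareSummable (q α : ℝ) (x : ℤ → ℂ) : Prop :=
  Summable fun k : ℤ => ((1 + Real.exp ((k + α) * Real.log q)) * ‖x k‖) ^ 2

variable {q α : ℝ} {x : ℤ → ℂ}

theorem IsSquareSummable.exists_norm_le (hx : IsSquareSummable q α x) :
    ∃ C, ∀ k : ℤ, ∀ δ : ℝ, ∀ w : ℂ, w.re ∈ Icc (Real.log q + δ) (-δ) →
      ‖x k * Complex.exp ((k + α : ℝ) * w)‖ ≤ C * Real.exp (-(δ * |k + α|)) := by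
  refine ⟨√(∑' k : ℤ, ((1 + Real.exp ((k + α) * Real.log q)) * ‖x k‖) ^ 2), fun k δ w hw => ?_⟩
  have hk := Real.le_sqrt_of_sq_le (hx.le_tsum k fun _ _ => sq_nonneg _)
  rw [norm_mul, Complex.norm_exp, Complex.re_ofReal_mul, mul_comm]
  calc Real.exp ((k + α) * w.re) * ‖x k‖
      ≤ Real.exp (-(δ * |k + α|)) * (1 + Real.exp ((k + α) * Real.log q)) * ‖x k‖ := by
        gcongr
        exact exp_mul_le_exp_neg_mul_abs hw _
    _ ≤ _ := by
        rw [mul_assoc, mul_comm]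
        gcongr

theorem IsSquareSummable.differentiableOn (hx : IsSquareSummable q α x) :
    DifferentiableOn ℂ (laurentSeries α x) (cover q) := by
  intro w hw
  obtain ⟨C, hC⟩ := hx.exists_norm_le
  obtain ⟨δ, hδ, hwδ⟩ := exists_mem_Ioo_shrink hw
  have hopen : IsOpen {z : ℂ | z.re ∈ Ioo (Real.log q + δ) (-δ)} :=
    isOpen_Ioo.preimage Complex.continuous_re
  have hdiff := Complex.differentiableOn_tsum_of_summable_norm
    ((summable_exp_neg_mul_abs_add hδ α).mul_left C)
    (fun k => (by fun_prop : Differentiable ℂ fun z => x k * Complex.exp ((k + α : ℝ) * z))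
      |>.differentiableOn) hopen fun k z hz => hC k δ z (Ioo_subset_Icc_self hz)
  exact (hdiff.differentiableAt (hopen.mem_nhds hwδ)).differentiableWithinAt

theorem laurentSeries_add_two_pi_I (w : ℂ) :
    laurentSeries α x (w + 2 * Real.pi * Complex.I) =
      Complex.exp (2 * Real.pi * Complex.I * α) * laurentSeries α x w := by
  simp only [laurentSeries, ← tsum_mul_left]
  refine tsum_congr fun k => ?_
  rw [mul_left_comm, ← Complex.exp_add]
  congr 1
  rw [Complex.exp_eq_exp_iff_exists_int]
  exact ⟨k, by push_cast; ring⟩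

theorem IsSquareSummable.fourierCoef_slice (hx : IsSquareSummable q α x) {s : ℝ}
    (hs : s ∈ Ioo (Real.log q) 0) (k : ℤ) :
    fourierCoef (k + α) (slice (laurentSeries α x) s) = Real.exp ((k + α) * s) * x k := by
  obtain ⟨C, hC⟩ := hx.exists_norm_le
  obtain ⟨δ, hδ, hsδ⟩ := exists_mem_Ioo_shrink hs
  have hsum : Summable fun j : ℤ => Real.exp ((j + α) * s) * x j := by
    refine .of_norm_bounded ((summable_exp_neg_mul_abs_add hδ α).mul_left C) fun j => ?_
    have h := hC j δ s (by simpa using Ioo_subset_Icc_self hsδ)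
    rwa [← Complex.ofReal_mul, ← Complex.ofReal_exp, mul_comm] at h
  rw [← fourierCoef_tsum hsum α k]
  congr 1
  funext t
  refine tsum_congr fun j => ?_
  rw [expChar, mul_comm _ (x j), mul_assoc]
  congr 1
  push_cast
  rw [← Complex.exp_add]
  ring_nf

theorem IsSquareSummable.exists_eLpNorm_slice_le (hx : IsSquareSummable q α x) :
    ∃ C : NNReal, ∀ s ∈ Ioo (Real.log q) 0, eLpNorm (slice (laurentSeries α x) s) 2 angle ≤ C := by
  refine ⟨Real.toNNReal √(2 * Real.pi *
    ∑' k : ℤ, ((1 + Real.exp ((k + α) * Real.log q)) * ‖x k‖) ^ 2), fun s hs => ?_⟩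
  have hmem := memLp_slice hx.differentiableOn hs 2
  rw [eLpNorm_eq_sqrt_tsum_fourierCoef hmem α]
  refine ENNReal.ofReal_le_ofReal (Real.sqrt_le_sqrt ?_)
  gcongr 2 * Real.pi * ?_
  refine (hasSum_sq_fourierCoef hmem α).summable.tsum_le_tsum (fun k => ?_) hx
  rw [hx.fourierCoef_slice hs, norm_mul, Complex.norm_of_nonneg (Real.exp_pos _).le]
  gcongr
  exact exp_mul_le_one_add_exp_mul (Ioo_subset_Icc_self hs) _

theorem IsSquareSummable.tendsto_tsum_exp_sub_exp (hx : IsSquareSummable q α x) {s₀ : ℝ}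
    (hs₀ : s₀ ∈ Icc (Real.log q) 0) {l : Filter ℝ} (hl : l ≤ 𝓝 s₀)
    (hmem : ∀ᶠ s in l, s ∈ Icc (Real.log q) 0) :
    Tendsto (fun s => ∑' k : ℤ,
      (|Real.exp ((k + α) * s) - Real.exp ((k + α) * s₀)| * ‖x k‖) ^ 2) l (𝓝 0) := by
  rw [← tsum_zero (β := ℤ)]
  refine tendsto_tsum_of_dominated_convergence hx (fun k => ?_) ?_
  · have hcont : Continuous fun s : ℝ =>
        (|Real.exp ((k + α) * s) - Real.exp ((k + α) * s₀)| * ‖x k‖) ^ 2 := by fun_prop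
    simpa using (hcont.tendsto s₀).mono_left hl
  · filter_upwards [hmem] with s hs k
    rw [Real.norm_of_nonneg (sq_nonneg _)]
    gcongr
    exact abs_sub_le_of_nonneg_of_le (Real.exp_pos _).le (exp_mul_le_one_add_exp_mul hs _)
      (Real.exp_pos _).le (exp_mul_le_one_add_exp_mul hs₀ _)

theorem IsSquareSummable.tendsto_slice (hx : IsSquareSummable q α x) {s₀ : ℝ}
    (hs₀ : s₀ ∈ Icc (Real.log q) 0) {l : Filter ℝ} (hl : l ≤ 𝓝 s₀)
    (hmem : ∀ᶠ s in l, s ∈ Ioo (Real.log q) 0) {u : ℝ → ℂ} (hu : MemLp u 2 angle)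
    (hcoef : ∀ k : ℤ, fourierCoef (k + α) u = Real.exp ((k + α) * s₀) * x k) :
    Tendsto (fun s => eLpNorm (slice (laurentSeries α x) s - u) 2 angle) l (𝓝 0) := by
  have hsum := hx.tendsto_tsum_exp_sub_exp hs₀ hl (hmem.mono fun _ hs => Ioo_subset_Icc_self hs)
  have hsqrt : Tendsto (fun v : ℝ => ENNReal.ofReal √(2 * Real.pi * v)) (𝓝 0) (𝓝 0) := by
    have hcont : Continuous fun v : ℝ => ENNReal.ofReal √(2 * Real.pi * v) :=
      ENNReal.continuous_ofReal.comp (by fun_prop)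
    simpa using hcont.tendsto 0
  refine (hsqrt.comp hsum).congr' ?_
  filter_upwards [hmem] with s hs
  have hslice := memLp_slice hx.differentiableOn hs 2
  rw [eLpNorm_eq_sqrt_tsum_fourierCoef (hslice.sub hu) α, Function.comp_apply]
  congr! 6 with k
  rw [fourierCoef_sub (hslice.integrable one_le_two) (hu.integrable one_le_two),
    hx.fourierCoef_slice hs, hcoef, ← sub_mul, norm_mul, ← Complex.ofReal_sub, Complex.norm_real,
    Real.norm_eq_abs]

end LaurentSeries

section HardySpace

variable {q α : ℝ} {g : ℂ → ℂ}

theorem LaurentRelation.isSquareSummable (hg : MemLp g 2 (boundaryMeasure q))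
    (h : LaurentRelation q α g) :
    IsSquareSummable q α fun k => fourierCoef (k + α) (g ∘ circ 1) := by
  have hsum := ((hasSum_sq_fourierCoef (memLp_comp_circ (circleMeasure_one_le q) hg) α).summable.add
    (hasSum_sq_fourierCoef (memLp_comp_circ (circleMeasure_inner_le q) hg) α).summable).mul_left 2
  refine hsum.of_nonneg_of_le (fun _ => sq_nonneg _) fun k => ?_
  rw [h k, norm_mul, Complex.norm_of_nonneg (Real.exp_pos _).le, add_mul, one_mul]
  exact add_sq_le

theorem LaurentRelation.exists_isHardy (hq : q ∈ Ioo (0 : ℝ) 1)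
    (hg : MemLp g 2 (boundaryMeasure q)) (h : LaurentRelation q α g) :
    ∃ F, IsHardy q α F ∧ HasBoundaryValue q F g := by
  have hlog := Real.log_neg hq.1 hq.2
  have hx := h.isSquareSummable hg
  refine ⟨_, ⟨hx.differentiableOn, fun w _ => laurentSeries_add_two_pi_I w,
    hx.exists_eLpNorm_slice_le⟩, ?_, ?_⟩
  · exact hx.tendsto_slice ⟨hlog.le, le_rfl⟩ nhdsWithin_le_nhds (Ioo_mem_nhdsLT hlog)
      (memLp_comp_circ (circleMeasure_one_le q) hg) fun k => by simp
  · exact hx.tendsto_slice ⟨le_rfl, hlog.le⟩ nhdsWithin_le_nhds (Ioo_mem_nhdsGT hlog)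
      (memLp_comp_circ (circleMeasure_inner_le q) hg) h

theorem mem_hardySpace_iff (hq : q ∈ Ioo (0 : ℝ) 1) {f : Lp ℂ 2 (boundaryMeasure q)} :
    f ∈ hardySpace hq α ↔ LaurentRelation q α f :=
  ⟨fun ⟨_, hF, hFf⟩ => hFf.laurentRelation hq hF.isAutomorphic (Lp.memLp f),
    fun h => h.exists_isHardy hq (Lp.memLp f)⟩

end HardySpace

section Compression

theorem isCompactOperator_of_summable_norm {ι E F : Type*} [NormedAddCommGroup E]
    [NormedSpace ℂ E] [NormedAddCommGroup F] [NormedSpace ℂ F] [CompleteSpace F]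
    {T : ι → E →L[ℂ] F} (hT : ∀ k, IsCompactOperator (T k)) (hs : Summable fun k => ‖T k‖) :
    IsCompactOperator (∑' k, T k : E →L[ℂ] F) := by
  have hcl : IsClosed {f : E →L[ℂ] F | IsCompactOperator f} := isClosed_setOfPred_isCompactOperator
  refine hcl.mem_of_tendsto (Summable.of_norm hs).hasSum (Eventually.of_forall fun s => ?_)
  exact (compactOperator (RingHom.id ℂ) E F).sum_mem fun k _ => hT k

variable {K : Type*} [NormedAddCommGroup K] [InnerProductSpace ℂ K]

theorem isCompactOperator_comp_starProjection {ι F : Type*} [NormedAddCommGroup F]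
    [NormedSpace ℂ F] [CompleteSpace F] {V : Submodule ℂ K} [V.HasOrthogonalProjection]
    (e : HilbertBasis ι ℂ V) {A : K →L[ℂ] F} (hA : Summable fun k => ‖A (e k)‖) :
    IsCompactOperator (A ∘L V.starProjection) := by
  let T : ι → K →L[ℂ] F := fun k => (innerSL ℂ (e k : K)).smulRight (A (e k))
  have hnorm : ∀ k, ‖T k‖ = ‖A (e k)‖ := fun k => by
    have h1 : ‖(e k : K)‖ = 1 := e.orthonormal.1 k
    rw [ContinuousLinearMap.norm_smulRight_apply, innerSL_apply_norm, h1, one_mul]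
  have hTc : ∀ k, IsCompactOperator (T k) := fun k => by
    have hinner : IsCompactOperator (innerSL ℂ (e k : K)) :=
      ⟨Metric.closedBall 0 1, isCompact_closedBall 0 1,
        (innerSL ℂ (e k : K)).continuous.continuousAt.preimage_mem_nhds
          (by simpa using Metric.closedBall_mem_nhds (0 : ℂ) one_pos)⟩
    exact hinner.clm_comp (ContinuousLinearMap.toSpanSingleton ℂ (A (e k)))
  have hs : Summable fun k => ‖T k‖ := by simpa only [hnorm] using hA
  have hsum : ∑' k, T k = A ∘L V.starProjection := by
    ext v
    have hTv : HasSum (fun k => T k v) ((∑' k, T k) v) :=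
      (Summable.of_norm hs).hasSum.mapL (ContinuousLinearMap.apply ℂ F v)
    have hrepr := (e.hasSum_repr (V.orthogonalProjectionOnto v)).mapL (A ∘L V.subtypeL)
    refine hTv.unique (hrepr.congr_fun fun k => ?_)
    rw [e.repr_apply_apply, map_smul, Submodule.inner_orthogonalProjectionOnto_eq_of_mem_left]
    rfl
  exact hsum ▸ isCompactOperator_of_summable_norm hTc hs

theorem exists_sub_sq_eq_of_sub_sq_apply_eq_smul {V : Type*} [AddCommGroup V] [Module ℂ V]
    {a : Module.End ℂ V} {κ : ℂ} {v : V} (hv : v ≠ 0) (h : a v - a (a v) = κ • v) :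
    ∃ ν : ℂ, ν - ν ^ 2 = κ ∧ ∃ w ≠ 0, a w = ν • w := by
  obtain ⟨s, hs⟩ := IsAlgClosed.exists_pow_nat_eq (1 - 4 * κ) two_pos
  obtain ⟨μ, hμ⟩ : ∃ μ : ℂ, μ - μ ^ 2 = κ := ⟨(1 + s) / 2, by linear_combination -hs / 4⟩
  -- `a - a² - κ` factors as `-(a - μ) (a - (1 - μ))`.
  by_cases hw : a v - (1 - μ) • v = 0
  · exact ⟨1 - μ, by linear_combination hμ, v, hv, sub_eq_zero.1 hw⟩
  · refine ⟨μ, hμ, _, hw, ?_⟩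
    rw [map_sub, map_smul, ← sub_sub_self (a v) (a (a v)), h, ← hμ]
    module

theorem exists_eigenvector_of_star_mul_self_eq_sub_mul_self [CompleteSpace K] {a Z : K →L[ℂ] K}
    (ha : IsSelfAdjoint a) (hZ : IsCompactOperator Z) (hZ0 : Z ≠ 0)
    (h : star Z * Z = a - a * a) : ∃ μ ∈ Ioo (0 : ℝ) 1, ∃ v ≠ 0, a v = (μ : ℂ) • v := by
  obtain ⟨κ, hκ, hκ0⟩ : ∃ κ : ℂ,
      Module.End.HasEigenvalue ((star Z * Z : K →L[ℂ] K) : K →ₗ[ℂ] K) κ ∧ κ ≠ 0 := by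
    by_contra! hall
    refine hZ0 ((CStarRing.star_mul_self_eq_zero_iff Z).1 ?_)
    exact (ContinuousLinearMap.eq_zero_of_forall_hasEigenvalue_eq_zero (hZ.clm_comp (star Z))
      (IsSelfAdjoint.star_mul_self Z).isSymmetric).1 hall
  obtain ⟨v₀, hv₀⟩ := hκ.exists_hasEigenvector
  have hκv : a v₀ - a (a v₀) = κ • v₀ := by simpa [h] using hv₀.apply_eq_smul
  obtain ⟨ν, hν, v, hv, hav⟩ :=
    exists_sub_sq_eq_of_sub_sq_apply_eq_smul (a := (a : K →ₗ[ℂ] K)) hv₀.2 hκv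
  replace hav : a v = ν • v := hav
  obtain ⟨μ, rfl⟩ : ∃ μ : ℝ, (μ : ℂ) = ν :=
    Complex.conj_eq_iff_real.1 (ha.isSymmetric.conj_eigenvalue_eq_self
      (Module.End.hasEigenvalue_of_hasEigenvector ⟨Module.End.mem_eigenspace_iff.2 hav, hv⟩)) |>.imp
        fun _ => Eq.symm
  have hpos : (μ - μ ^ 2) * ‖v‖ ^ 2 = ‖Z v‖ ^ 2 := by
    have hZv : (star Z * Z) v = ((μ - μ ^ 2 : ℝ) : ℂ) • v := by
      rw [h, sub_apply, mul_apply_eq_comp, hav, map_smul, hav]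
      push_cast
      module
    have hinner : inner ℂ v ((star Z * Z) v) = inner ℂ (Z v) (Z v) :=
      ContinuousLinearMap.adjoint_inner_right Z v (Z v)
    rw [hZv, inner_smul_right, inner_self_eq_norm_sq_to_K, inner_self_eq_norm_sq_to_K] at hinner
    exact_mod_cast (show ((μ - μ ^ 2 : ℝ) : ℂ) * (‖v‖ : ℂ) ^ 2 = (‖Z v‖ : ℂ) ^ 2 from hinner)
  have hμ0 : μ - μ ^ 2 ≠ 0 := fun h0 => hκ0 (by rw [← hν]; exact_mod_cast h0)
  have hμ : 0 < μ - μ ^ 2 :=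
    lt_of_le_of_ne (nonneg_of_mul_nonneg_left (hpos ▸ sq_nonneg _) (by positivity)) hμ0.symm
  exact ⟨μ, ⟨by nlinarith, by nlinarith⟩, v, hv, hav⟩

theorem exists_eigenvector_compression [CompleteSpace K] {U : Submodule ℂ K}
    [U.HasOrthogonalProjection] {E : K →L[ℂ] K} (hE : IsStarProjection E)
    (hc : IsCompactOperator ((1 - U.starProjection) * E * U.starProjection : K →L[ℂ] K))
    (hne : (1 - U.starProjection) * E * U.starProjection ≠ 0) :
    ∃ μ ∈ Ioo (0 : ℝ) 1, ∃ v ∈ U, v ≠ 0 ∧ U.starProjection (E v) = (μ : ℂ) • v := by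
  set P := U.starProjection
  have hP : IsStarProjection P := isStarProjection_starProjection
  have hQ : IsStarProjection (1 - P) := hP.one_sub
  have hself : IsSelfAdjoint (P * E * P) := by
    simp only [isSelfAdjoint_iff, star_mul, hP.isSelfAdjoint.star_eq, hE.isSelfAdjoint.star_eq,
      mul_assoc]
  have hdef : star ((1 - P) * E * P) * ((1 - P) * E * P) = P * E * P - P * E * P * (P * E * P) :=
    calc star ((1 - P) * E * P) * ((1 - P) * E * P)
        = P * E * ((1 - P) * (1 - P)) * E * P := by
          simp only [star_mul, hQ.isSelfAdjoint.star_eq, hP.isSelfAdjoint.star_eq,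
            hE.isSelfAdjoint.star_eq, mul_assoc]
      _ = P * (E * E) * P - P * E * (P * P) * E * P := by
          rw [hQ.isIdempotentElem.eq, hP.isIdempotentElem.eq]; noncomm_ring
      _ = P * E * P - P * E * P * (P * E * P) := by
          rw [hE.isIdempotentElem.eq]; simp only [mul_assoc]
  obtain ⟨μ, hμ, v, hv, hav⟩ :=
    exists_eigenvector_of_star_mul_self_eq_sub_mul_self hself hc hne hdef
  have hvU : v ∈ U := by
    have hmem : (μ : ℂ) • v ∈ U := hav ▸ U.starProjection_apply_mem _
    exact (U.smul_mem_iff (by exact_mod_cast hμ.1.ne')).1 hmem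
  refine ⟨μ, hμ, v, hvU, hv, ?_⟩
  rw [← hav, mul_apply_eq_comp, Submodule.starProjection_eq_self_iff.2 hvU]
  rfl

theorem isCompactOperator_compression {ι : Type*} {V U : Submodule ℂ K} [CompleteSpace K]
    [V.HasOrthogonalProjection] [U.HasOrthogonalProjection] (e : HilbertBasis ι ℂ V)
    {E : K →L[ℂ] K} (S : K ≃L[ℂ] K) (hSE : ∀ f, S (E f) = E (S f)) (hSU : ∀ f, S f ∈ U ↔ f ∈ V)
    (hsum : Summable fun k => min ‖E (e k)‖ ‖(e k : K) - E (e k)‖) :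
    IsCompactOperator ((1 - U.starProjection) * E * U.starProjection : K →L[ℂ] K) := by
  let Q : K →L[ℂ] K := (1 - U.starProjection) * (S : K →L[ℂ] K)
  have hQ : ∀ f ∈ V, Q f = 0 := fun f hf =>
    sub_eq_zero.2 (Submodule.starProjection_eq_self_iff.2 ((hSU f).2 hf)).symm
  have hle : ∀ k, ‖(Q * E) (e k)‖ ≤ ‖Q‖ * min ‖E (e k)‖ ‖(e k : K) - E (e k)‖ := fun k => by
    have hsub : Q (E (e k)) = -Q (e k - E (e k)) := by
      rw [map_sub, hQ _ (e k).2, zero_sub, neg_neg]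
    rw [mul_min_of_nonneg _ _ (norm_nonneg _), le_min_iff, mul_apply_eq_comp]
    refine ⟨Q.le_opNorm _, ?_⟩
    rw [hsub, norm_neg]
    exact Q.le_opNorm _
  have hcomp := isCompactOperator_comp_starProjection e
    (.of_nonneg_of_le (fun k => norm_nonneg _) hle (hsum.mul_left ‖Q‖))
  have hfactor : (1 - U.starProjection) * E * U.starProjection =
      ((Q * E) ∘L V.starProjection) ∘L ((S.symm : K →L[ℂ] K) ∘L U.starProjection) := by
    ext v
    have hv : V.starProjection (S.symm (U.starProjection v)) = S.symm (U.starProjection v) :=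
      Submodule.starProjection_eq_self_iff.2 <| (hSU _).1 <| by
        rw [S.apply_symm_apply]
        exact U.starProjection_apply_mem v
    change (1 - U.starProjection) (E (U.starProjection v)) =
      (1 - U.starProjection) (S (E (V.starProjection (S.symm (U.starProjection v)))))
    rw [hv, hSE, S.apply_symm_apply]
  rw [hfactor]
  exact hcomp.comp_clm _

theorem exists_weighted_eigenvector [CompleteSpace K] {ι : Type*} {V : Submodule ℂ K}
    [CompleteSpace V] (e : HilbertBasis ι ℂ V) {E : K →L[ℂ] K} (hE : IsStarProjection E)
    (S : K ≃L[ℂ] K) (hSE : ∀ f, S (E f) = E (S f))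
    (hsum : Summable fun k => min ‖E (e k)‖ ‖(e k : K) - E (e k)‖) (hne : ∃ f ∈ V, E f ∉ V) :
    ∃ μ ∈ Ioo (0 : ℝ) 1, ∃ f ∈ V, f ≠ 0 ∧
      ∀ h ∈ V, inner ℂ (S h) (S (E f - (μ : ℂ) • f)) = 0 := by
  let U : Submodule ℂ K := V.comap (S.symm : K →ₗ[ℂ] K)
  have hSU : ∀ f, S f ∈ U ↔ f ∈ V := fun f => by
    rw [Submodule.mem_comap]
    exact iff_of_eq (congrArg (· ∈ V) (S.symm_apply_apply f))
  have hVcl : IsClosed (V : Set K) := (completeSpace_coe_iff_isComplete.1 ‹_›).isClosed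
  have : CompleteSpace U := (hVcl.preimage S.symm.continuous).completeSpace_coe
  set P := U.starProjection
  have hne' : (1 - P) * E * P ≠ 0 := by
    obtain ⟨f, hf, hEf⟩ := hne
    refine fun h0 => hEf ((hSU _).1 ?_)
    have happ : E (P (S f)) - P (E (P (S f))) = 0 := DFunLike.congr_fun h0 (S f)
    rw [Submodule.starProjection_eq_self_iff.2 ((hSU f).2 hf), ← hSE, sub_eq_zero] at happ
    exact happ ▸ U.starProjection_apply_mem _
  obtain ⟨μ, hμ, v, hvU, hv0, hPE⟩ :=
    exists_eigenvector_compression hE (isCompactOperator_compression e S hSE hSU hsum) hne'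
  refine ⟨μ, hμ, S.symm v, hvU, by simpa using hv0, fun h hh => ?_⟩
  have hres : S (E (S.symm v) - (μ : ℂ) • S.symm v) = E v - P (E v) := by
    rw [map_sub, map_smul, hSE, S.apply_symm_apply, hPE]
  rw [hres]
  exact U.inner_right_of_mem_orthogonal ((hSU h).2 hh) (U.sub_starProjection_mem_orthogonal _)

end Compression

section Multiplication

variable {X : Type*} [MeasurableSpace X] {ν : Measure X}

/-- Multiplication by an essentially bounded function, as an operator on `L²`. -/
def mulOp {m : X → ℂ} (hm : MemLp m ∞ ν) : Lp ℂ 2 ν →L[ℂ] Lp ℂ 2 ν :=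
  (ContinuousLinearMap.mul ℂ ℂ).holderL ν ∞ 2 2 hm.toLp

theorem coeFn_mulOp {m : X → ℂ} (hm : MemLp m ∞ ν) (f : Lp ℂ 2 ν) :
    mulOp hm f =ᵐ[ν] fun z => m z * f z := by
  filter_upwards [(ContinuousLinearMap.mul ℂ ℂ).coeFn_holder (r := 2) hm.toLp f, hm.coeFn_toLp]
    with z hz hm
  rw [← hm]
  exact hz

theorem mulOp_comm {m n : X → ℂ} (hm : MemLp m ∞ ν) (hn : MemLp n ∞ ν) (f : Lp ℂ 2 ν) :
    mulOp hm (mulOp hn f) = mulOp hn (mulOp hm f) := by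
  ext1
  filter_upwards [coeFn_mulOp hm (mulOp hn f), coeFn_mulOp hn (mulOp hm f), coeFn_mulOp hm f,
    coeFn_mulOp hn f] with z h₁ h₂ h₃ h₄
  rw [h₁, h₂, h₃, h₄, mul_left_comm]

theorem mulOp_mulOp_cancel {m n : X → ℂ} (hm : MemLp m ∞ ν) (hn : MemLp n ∞ ν)
    (hmn : ∀ᵐ z ∂ν, m z * n z = 1) (f : Lp ℂ 2 ν) : mulOp hm (mulOp hn f) = f := by
  ext1
  filter_upwards [coeFn_mulOp hm (mulOp hn f), coeFn_mulOp hn f, hmn] with z h₁ h₂ h₃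
  rw [h₁, h₂, ← mul_assoc, h₃, one_mul]

theorem inner_Lp_eq_integral (f g : Lp ℂ 2 ν) :
    inner ℂ f g = ∫ z, starRingEnd ℂ (f z) * g z ∂ν := by
  simp only [L2.inner_def, RCLike.inner_apply']

theorem integrable_conj_mul (f g : Lp ℂ 2 ν) :
    Integrable (fun z => starRingEnd ℂ (f z) * g z) ν := by
  simpa only [RCLike.inner_apply'] using L2.integrable_inner (𝕜 := ℂ) f g

theorem isStarProjection_mulOp {m : X → ℂ} (hm : MemLp m ∞ ν)
    (hproj : ∀ z, IsStarProjection (m z)) : IsStarProjection (mulOp hm) where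
  isIdempotentElem := by
    ext f : 2
    filter_upwards [coeFn_mulOp hm (mulOp hm f), coeFn_mulOp hm f] with z h₁ h₂
    rw [mul_apply_eq_comp, h₁, h₂, ← mul_assoc, (hproj z).isIdempotentElem.eq]
  isSelfAdjoint := by
    refine ContinuousLinearMap.isSelfAdjoint_iff_isSymmetric.2 fun f g => ?_
    change inner ℂ (mulOp hm f) g = inner ℂ f (mulOp hm g)
    rw [inner_Lp_eq_integral, inner_Lp_eq_integral]
    refine integral_congr_ae ?_
    filter_upwards [coeFn_mulOp hm f, coeFn_mulOp hm g] with z h₁ h₂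
    rw [h₁, h₂, map_mul, (hproj z).isSelfAdjoint.conj_eq]
    ring

end Multiplication

section Powers

theorem ae_comp_circ {ρ : ℝ} {ν : Measure ℂ} (hρ : circleMeasure ρ ≤ ν) {P : ℂ → Prop}
    (h : ∀ᵐ z ∂ν, P z) : ∀ᵐ t ∂angle, P (circ ρ t) :=
  ae_of_ae_map (measurable_circ ρ).aemeasurable (ae_mono hρ h)

theorem circ_cpow {ρ : ℝ} (hρ : 0 < ρ) (b : ℝ) :
    ∀ᵐ t ∂angle, circ ρ t ^ (b : ℂ) = (Real.exp (b * Real.log ρ) : ℝ) * expChar b t := by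
  filter_upwards [ae_restrict_mem measurableSet_Ioc] with t ht
  rw [Complex.cpow_def_of_ne_zero (circ_ne_zero hρ t), Complex.log, norm_circ hρ.le,
    arg_circ hρ ht, expChar, Complex.ofReal_exp, ← Complex.exp_add]
  push_cast
  ring_nf

variable {q α : ℝ}

theorem ae_ne_zero (hq : 0 < q) : ∀ᵐ z ∂boundaryMeasure q, z ≠ 0 :=
  (ae_boundaryMeasure_iff hq).2
    ⟨.of_forall (circ_ne_zero one_pos), .of_forall (circ_ne_zero hq)⟩

theorem norm_circ_cpow {ρ : ℝ} (hρ : 0 < ρ) (b t : ℝ) :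
    ‖circ ρ t ^ (b : ℂ)‖ = Real.exp (b * Real.log ρ) := by
  rw [Complex.norm_cpow_real, norm_circ hρ.le, Real.rpow_def_of_pos hρ, mul_comm]

theorem memLp_cpow (hq : 0 < q) (b : ℝ) :
    MemLp (fun z : ℂ => z ^ (b : ℂ)) ∞ (boundaryMeasure q) := by
  have hmeas : Measurable fun z : ℂ => z ^ (b : ℂ) := by fun_prop
  refine memLp_top_of_bound hmeas.aestronglyMeasurable (max 1 (Real.exp (b * Real.log q)))
    ((ae_boundaryMeasure_iff hq).2 ⟨.of_forall fun t => ?_, .of_forall fun t => ?_⟩)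
  · simp [norm_circ_cpow one_pos]
  · simp [norm_circ_cpow hq]

theorem LaurentRelation.congr {f g : ℂ → ℂ} (hf : LaurentRelation q α f)
    (hfg : f =ᵐ[boundaryMeasure q] g) : LaurentRelation q α g := by
  have hinner : f ∘ circ q =ᵐ[angle] g ∘ circ q := ae_comp_circ (circleMeasure_inner_le q) hfg
  have houter : f ∘ circ 1 =ᵐ[angle] g ∘ circ 1 := ae_comp_circ (circleMeasure_one_le q) hfg
  intro k
  rw [← fourierCoef_congr hinner, ← fourierCoef_congr houter, hf k]

theorem fourierCoef_cpow_mul {ρ : ℝ} (hρ : 0 < ρ) (a b : ℝ) (g : ℂ → ℂ) :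
    fourierCoef (a + b) ((fun z => z ^ (b : ℂ) * g z) ∘ circ ρ) =
      Real.exp (b * Real.log ρ) * fourierCoef a (g ∘ circ ρ) := by
  rw [← fourierCoef_smul, ← fourierCoef_mul_expChar b a]
  refine fourierCoef_congr ?_ _
  filter_upwards [circ_cpow hρ b] with t ht
  simp only [Function.comp_apply, Pi.mul_apply, Pi.smul_apply, smul_eq_mul, ht]
  ring

theorem LaurentRelation.cpow_mul (hq : 0 < q) {g : ℂ → ℂ} (hg : LaurentRelation q α g) (b : ℝ) :
    LaurentRelation q (α + b) fun z => z ^ (b : ℂ) * g z := by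
  intro k
  rw [← add_assoc, fourierCoef_cpow_mul hq, fourierCoef_cpow_mul one_pos, hg k, Real.log_one,
    mul_zero, Real.exp_zero, add_mul _ b, Real.exp_add]
  push_cast
  ring

theorem laurentRelation_add_int_iff {g : ℂ → ℂ} (n : ℤ) :
    LaurentRelation q (α + n) g ↔ LaurentRelation q α g := by
  have hshift (k : ℤ) : (k : ℝ) + (α + n) = (Equiv.addRight n k : ℤ) + α := by
    simp only [Equiv.coe_addRight, Int.cast_add]
    ring
  unfold LaurentRelation
  simp only [hshift]
  exact (Equiv.addRight n).forall_congr_right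
    (q := fun k : ℤ => fourierCoef (k + α) (g ∘ circ q) =
      Real.exp ((k + α) * Real.log q) * fourierCoef (k + α) (g ∘ circ 1))

end Powers

section HardyModule

variable {q α : ℝ} (hq : q ∈ Ioo (0 : ℝ) 1)

theorem mulOp_cpow_mem_hardySpace {g : Lp ℂ 2 (boundaryMeasure q)} (hg : g ∈ hardySpace hq α)
    (b : ℝ) : mulOp (memLp_cpow hq.1 b) g ∈ hardySpace hq (α + b) := by
  rw [mem_hardySpace_iff] at hg ⊢
  exact (hg.cpow_mul hq.1 b).congr (coeFn_mulOp _ g).symm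

theorem hardySpace_add_int (α : ℝ) (n : ℤ) : hardySpace hq (α + n) = hardySpace hq α := by
  ext g
  rw [mem_hardySpace_iff, mem_hardySpace_iff, laurentRelation_add_int_iff]

theorem toeplitz_eq_smul_iff {φ : Lp ℝ ∞ (boundaryMeasure q)} {g : hardySpace hq α} {c : ℂ} :
    toeplitz hq α φ g = c • (g : Lp ℂ 2 (boundaryMeasure q)) ↔
      ∀ h ∈ hardySpace hq α, ∫ z, starRingEnd ℂ (h z) *
        ((φ z - c) * (g : Lp ℂ 2 (boundaryMeasure q)) z) ∂boundaryMeasure q = 0 := by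
  obtain ⟨g, hg⟩ := g
  have hproj : (hardySpace hq α).topologicalClosure.starProjection (c • g) = c • g :=
    Submodule.starProjection_eq_self_iff.2
      (Submodule.smul_mem _ _ (Submodule.le_topologicalClosure _ hg))
  rw [toeplitz, ← sub_eq_zero, ← hproj, ← map_sub, Submodule.starProjection_apply_eq_zero_iff,
    Submodule.orthogonal_closure, Submodule.mem_orthogonal]
  refine forall₂_congr fun h _ => ?_
  rw [inner_Lp_eq_integral]
  refine Eq.congr_left (integral_congr_ae ?_)
  filter_upwards [Lp.coeFn_sub (φ • g : Lp ℂ 2 (boundaryMeasure q)) (c • g), Lp.coeFn_smul c g,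
    Lp.coeFn_lpSMul (r := 2) φ g] with z hsub hsmul hφ
  rw [hsub, Pi.sub_apply, hsmul, hφ, Pi.smul_apply', Pi.smul_apply, Complex.real_smul,
    smul_eq_mul, sub_mul]

theorem continuous_fourierCoef_comp_circ {ρ : ℝ} {ν : Measure ℂ} (hρ : circleMeasure ρ ≤ ν)
    (b : ℝ) : Continuous fun g : Lp ℂ 2 ν => fourierCoef b (g ∘ circ ρ) := by
  have hmem (h : Lp ℂ 2 ν) : MemLp (h ∘ circ ρ) 2 angle := memLp_comp_circ hρ (Lp.memLp h)
  refine continuous_iff_continuousAt.2 fun g =>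
    tendsto_fourierCoef_of_eLpNorm_two (.of_forall hmem) (hmem g) ?_ b
  have hg := (Lp.tendsto_Lp_iff_tendsto_eLpNorm' (fun h : Lp ℂ 2 ν => h) g).1 tendsto_id
  refine tendsto_of_tendsto_of_tendsto_of_le_of_le tendsto_const_nhds hg (fun _ => zero_le)
    fun h => ?_
  have hsub : AEStronglyMeasurable ((h : ℂ → ℂ) - (g : ℂ → ℂ)) (circleMeasure ρ) :=
    (((Lp.memLp h).sub (Lp.memLp g)).mono_measure hρ).1
  exact (eLpNorm_map_measure (p := 2) hsub (measurable_circ ρ).aemeasurable).symm.trans_le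
    (eLpNorm_mono_measure _ hρ)

theorem isClosed_hardySpace (α : ℝ) :
    IsClosed (hardySpace hq α : Set (Lp ℂ 2 (boundaryMeasure q))) := by
  simp only [← SetLike.setOfPred_mem_eq, mem_hardySpace_iff, LaurentRelation, ofPred_forall]
  exact isClosed_iInter fun k =>
    isClosed_eq (continuous_fourierCoef_comp_circ (circleMeasure_inner_le q) _)
      (continuous_const.mul (continuous_fourierCoef_comp_circ (circleMeasure_one_le q) _))

theorem eq_zero_of_fourierCoef_eq_zero {g : Lp ℂ 2 (boundaryMeasure q)}
    (hg : g ∈ hardySpace hq α) (h : ∀ k : ℤ, fourierCoef (k + α) (g ∘ circ 1) = 0) : g = 0 := by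
  rw [mem_hardySpace_iff] at hg
  rw [Lp.eq_zero_iff_ae_eq_zero]
  refine (ae_boundaryMeasure_iff hq.1).2 ⟨?_, ?_⟩
  · exact ae_eq_zero_of_fourierCoef_eq_zero
      (memLp_comp_circ (circleMeasure_one_le q) (Lp.memLp g)) α h
  · refine ae_eq_zero_of_fourierCoef_eq_zero
      (memLp_comp_circ (circleMeasure_inner_le q) (Lp.memLp g)) α fun k =>
        (hg k).trans (by rw [h k, mul_zero])

end HardyModule

section Monomials

variable {q : ℝ} (hq : q ∈ Ioo (0 : ℝ) 1)

/-- The power `z ^ k`, as an element of `L²(B)`. -/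
def monomial (k : ℤ) : Lp ℂ 2 (boundaryMeasure q) :=
  ((memLp_cpow hq.1 k).mono_exponent le_top).toLp

theorem monomial_circ {ρ : ℝ} (hρ : 0 < ρ) (hρB : circleMeasure ρ ≤ boundaryMeasure q) (k : ℤ) :
    ∀ᵐ t ∂angle, monomial hq k (circ ρ t) = (Real.exp (k * Real.log ρ) : ℝ) * expChar k t := by
  filter_upwards [ae_comp_circ hρB ((memLp_cpow hq.1 k).mono_exponent le_top).coeFn_toLp,
    circ_cpow hρ k] with t h₁ h₂
  rw [monomial, h₁, h₂]

theorem fourierCoef_monomial {ρ : ℝ} (hρ : 0 < ρ) (hρB : circleMeasure ρ ≤ boundaryMeasure q)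
    (j k : ℤ) : fourierCoef j (monomial hq k ∘ circ ρ) =
      Real.exp (k * Real.log ρ) * Pi.single (M := fun _ => ℂ) k 1 j := by
  have h := fourierCoef_expChar j k 0
  rw [add_zero, add_zero] at h
  rw [← h, ← fourierCoef_smul]
  exact fourierCoef_congr (monomial_circ hq hρ hρB k) _

theorem monomial_mem_hardySpace (k : ℤ) : monomial hq k ∈ hardySpace hq 0 := by
  rw [mem_hardySpace_iff]
  intro j
  rw [add_zero, fourierCoef_monomial hq hq.1 (circleMeasure_inner_le q),
    fourierCoef_monomial hq one_pos (circleMeasure_one_le q), Real.log_one, mul_zero,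
    Real.exp_zero, Complex.ofReal_one, one_mul]
  obtain rfl | hjk := eq_or_ne j k
  · rfl
  · simp only [Pi.single_eq_of_ne hjk, mul_zero]

theorem inner_monomial (k : ℤ) (g : Lp ℂ 2 (boundaryMeasure q)) :
    inner ℂ (monomial hq k) g = 2 * Real.pi * (fourierCoef k (g ∘ circ 1) +
      Real.exp (k * Real.log q) * fourierCoef k (g ∘ circ q)) := by
  have hcircle {ρ : ℝ} (hρ : 0 < ρ) (hρB : circleMeasure ρ ≤ boundaryMeasure q) :
      ∫ t, starRingEnd ℂ (monomial hq k (circ ρ t)) * g (circ ρ t) ∂angle =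
        2 * Real.pi * (Real.exp (k * Real.log ρ) * fourierCoef k (g ∘ circ ρ)) := by
    have hpi : (Real.pi : ℂ) ≠ 0 := Complex.ofReal_ne_zero.2 Real.pi_ne_zero
    rw [fourierCoef, Complex.real_smul, mul_left_comm (Real.exp _ : ℂ), ← mul_assoc,
      Complex.ofReal_inv, Complex.ofReal_mul, Complex.ofReal_ofNat,
      mul_inv_cancel₀ (mul_ne_zero two_ne_zero hpi), one_mul, ← integral_const_mul]
    refine integral_congr_ae ?_
    filter_upwards [monomial_circ hq hρ hρB k] with t ht
    rw [ht, map_mul, Complex.conj_ofReal, ← expChar_neg, Function.comp_apply]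
    ring
  rw [inner_Lp_eq_integral, integral_boundaryMeasure (integrable_conj_mul _ _),
    hcircle one_pos (circleMeasure_one_le q), hcircle hq.1 (circleMeasure_inner_le q),
    Real.log_one, mul_zero, Real.exp_zero, Complex.ofReal_one, one_mul, mul_add]

theorem inner_monomial_of_mem {g : Lp ℂ 2 (boundaryMeasure q)} (hg : g ∈ hardySpace hq 0)
    (k : ℤ) : inner ℂ (monomial hq k) g =
      2 * Real.pi * (1 + Real.exp (k * Real.log q) ^ 2) * fourierCoef k (g ∘ circ 1) := by
  have hrel := (mem_hardySpace_iff hq).1 hg k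
  rw [add_zero] at hrel
  rw [inner_monomial, hrel]
  ring

theorem two_pi_mul_one_add_sq_ne_zero (x : ℝ) : (2 * Real.pi * (1 + x ^ 2) : ℂ) ≠ 0 := by
  have : 2 * Real.pi * (1 + x ^ 2) ≠ 0 := by positivity
  exact_mod_cast this

theorem inner_monomial_monomial (j k : ℤ) : inner ℂ (monomial hq j) (monomial hq k) =
    2 * Real.pi * (1 + Real.exp (j * Real.log q) ^ 2) * Pi.single (M := fun _ => ℂ) k 1 j := by
  rw [inner_monomial_of_mem hq (monomial_mem_hardySpace hq k),
    fourierCoef_monomial hq one_pos (circleMeasure_one_le q), Real.log_one, mul_zero,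
    Real.exp_zero, Complex.ofReal_one, one_mul]

theorem monomial_ne_zero (k : ℤ) : monomial hq k ≠ 0 := by
  rw [← inner_self_ne_zero (𝕜 := ℂ), inner_monomial_monomial, Pi.single_eq_same, mul_one]
  exact two_pi_mul_one_add_sq_ne_zero _

/-- The normalized monomials, as elements of `H²₀`. -/
def unitMonomial (k : ℤ) : hardySpace hq 0 :=
  ⟨((‖monomial hq k‖⁻¹ : ℝ) : ℂ) • monomial hq k,
    Submodule.smul_mem _ _ (monomial_mem_hardySpace hq k)⟩

theorem orthonormal_unitMonomial : Orthonormal ℂ (unitMonomial hq) := by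
  refine ⟨fun k => ?_, fun j k hjk => ?_⟩
  · change ‖((‖monomial hq k‖⁻¹ : ℝ) : ℂ) • monomial hq k‖ = 1
    rw [norm_smul, Complex.norm_real, norm_inv, norm_norm,
      inv_mul_cancel₀ (norm_ne_zero_iff.2 (monomial_ne_zero hq k))]
  · change inner ℂ (unitMonomial hq j) (unitMonomial hq k) = 0
    rw [Submodule.coe_inner, unitMonomial, unitMonomial, inner_smul_left, inner_smul_right,
      inner_monomial_monomial, Pi.single_eq_of_ne hjk, mul_zero, mul_zero, mul_zero]

instance completeSpace_hardySpace (α : ℝ) : CompleteSpace (hardySpace hq α) :=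
  (isClosed_hardySpace hq α).completeSpace_coe

theorem span_unitMonomial_orthogonal :
    (Submodule.span ℂ (range (unitMonomial hq)))ᗮ = ⊥ := by
  refine (Submodule.eq_bot_iff _).2 fun g hg => Subtype.ext ?_
  refine eq_zero_of_fourierCoef_eq_zero hq g.2 fun k => ?_
  have horth : inner ℂ (unitMonomial hq k) g = 0 :=
    hg _ (Submodule.subset_span (mem_range_self k))
  have hnorm : starRingEnd ℂ ((‖monomial hq k‖⁻¹ : ℝ) : ℂ) ≠ 0 := by
    rw [Complex.conj_ofReal]
    exact Complex.ofReal_ne_zero.2 (inv_ne_zero (norm_ne_zero_iff.2 (monomial_ne_zero hq k)))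
  rw [Submodule.coe_inner, unitMonomial, inner_smul_left, mul_eq_zero_iff_left hnorm,
    inner_monomial_of_mem hq g.2, mul_eq_zero_iff_left (two_pi_mul_one_add_sq_ne_zero _)] at horth
  rw [add_zero, horth]

/-- The Hilbert basis of `H²₀` formed by the normalized monomials. -/
def monomialBasis : HilbertBasis ℤ ℂ (hardySpace hq 0) :=
  .mkOfOrthogonalEqBot (orthonormal_unitMonomial hq) (span_unitMonomial_orthogonal hq)

theorem coe_monomialBasis (k : ℤ) : (monomialBasis hq k : Lp ℂ 2 (boundaryMeasure q)) =
    ((‖monomial hq k‖⁻¹ : ℝ) : ℂ) • monomial hq k := by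
  rw [monomialBasis, HilbertBasis.coe_mkOfOrthogonalEqBot, unitMonomial]

end Monomials

section OuterProjection

variable {q : ℝ}

/-- The indicator function of the outer boundary circle. -/
def outerIndicator : ℂ → ℂ := (Metric.sphere 0 1).indicator 1

theorem outerIndicator_circ_one (t : ℝ) : outerIndicator (circ 1 t) = 1 :=
  indicator_of_mem (by rw [mem_sphere_zero_iff_norm, norm_circ zero_le_one]) _

theorem outerIndicator_circ (hq : q ∈ Ioo (0 : ℝ) 1) (t : ℝ) : outerIndicator (circ q t) = 0 :=
  indicator_of_notMem
    (by rw [mem_sphere_zero_iff_norm, norm_circ hq.1.le]; exact hq.2.ne) _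

theorem memLp_outerIndicator {ν : Measure ℂ} : MemLp outerIndicator ∞ ν :=
  memLp_top_of_bound
    (measurable_one.indicator Metric.isClosed_sphere.measurableSet).aestronglyMeasurable 1
    (.of_forall fun _ => (norm_indicator_le_norm_self _ _).trans_eq norm_one)

/-- The orthogonal projection of `L²(B)` onto the functions that vanish on the inner circle. -/
def outerProj : Lp ℂ 2 (boundaryMeasure q) →L[ℂ] Lp ℂ 2 (boundaryMeasure q) :=
  mulOp memLp_outerIndicator

theorem isStarProjection_outerProj : IsStarProjection (outerProj (q := q)) := by
  refine isStarProjection_mulOp _ fun z => ?_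
  obtain h | h := indicator_eq_zero_or_self (Metric.sphere (0 : ℂ) 1) (1 : ℂ → ℂ) z
  · rw [outerIndicator, h]; exact .zero ℂ
  · rw [outerIndicator, h]; exact .one ℂ

theorem outerProj_comp_circ_one (f : Lp ℂ 2 (boundaryMeasure q)) :
    outerProj f ∘ circ 1 =ᵐ[angle] f ∘ circ 1 := by
  filter_upwards [ae_comp_circ (circleMeasure_one_le q) (coeFn_mulOp memLp_outerIndicator f)]
    with t ht
  rw [Function.comp_apply, outerProj, ht, outerIndicator_circ_one, one_mul, Function.comp_apply]

theorem outerProj_comp_circ (hq : q ∈ Ioo (0 : ℝ) 1) (f : Lp ℂ 2 (boundaryMeasure q)) :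
    outerProj f ∘ circ q =ᵐ[angle] 0 := by
  filter_upwards [ae_comp_circ (circleMeasure_inner_le q) (coeFn_mulOp memLp_outerIndicator f)]
    with t ht
  rw [Function.comp_apply, outerProj, ht, outerIndicator_circ hq, zero_mul, Pi.zero_apply]

theorem fourierCoef_outerProj_comp_circ (hq : q ∈ Ioo (0 : ℝ) 1) (b : ℝ)
    (f : Lp ℂ 2 (boundaryMeasure q)) :
    fourierCoef b (outerProj f ∘ circ q) = 0 := by
  rw [fourierCoef_congr (outerProj_comp_circ hq f)]
  simp only [fourierCoef, Pi.zero_apply, zero_mul, integral_zero, smul_zero]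

variable (hq : q ∈ Ioo (0 : ℝ) 1)

theorem norm_sq_monomial (k : ℤ) :
    ‖monomial hq k‖ ^ 2 = 2 * Real.pi * (1 + Real.exp (k * Real.log q) ^ 2) := by
  rw [← inner_self_eq_norm_sq (𝕜 := ℂ), inner_monomial_monomial, Pi.single_eq_same, mul_one,
    RCLike.re_eq_complex_re]
  exact_mod_cast Complex.ofReal_re _

theorem fourierCoef_outerProj_monomial_comp_circ_one (k : ℤ) :
    fourierCoef k (outerProj (monomial hq k) ∘ circ 1) = 1 := by
  rw [fourierCoef_congr (outerProj_comp_circ_one _),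
    fourierCoef_monomial hq one_pos (circleMeasure_one_le q), Pi.single_eq_same, Real.log_one,
    mul_zero, Real.exp_zero, Complex.ofReal_one, one_mul]

theorem inner_monomial_outerProj_self (k : ℤ) :
    inner ℂ (monomial hq k) (outerProj (monomial hq k)) = (2 * Real.pi : ℝ) := by
  rw [inner_monomial, fourierCoef_outerProj_monomial_comp_circ_one,
    fourierCoef_outerProj_comp_circ hq, mul_zero, add_zero, mul_one]
  norm_cast

theorem norm_sq_outerProj_monomial (k : ℤ) :
    ‖outerProj (monomial hq k)‖ ^ 2 = 2 * Real.pi := by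
  have hidem : outerProj (outerProj (monomial hq k)) = outerProj (monomial hq k) :=
    congr($(isStarProjection_outerProj.isIdempotentElem.eq) (monomial hq k))
  have hsymm : inner ℂ (outerProj (monomial hq k)) (outerProj (monomial hq k)) =
      inner ℂ (monomial hq k) (outerProj (outerProj (monomial hq k))) :=
    isStarProjection_outerProj.isSelfAdjoint.isSymmetric _ _
  rw [← inner_self_eq_norm_sq (𝕜 := ℂ), hsymm, hidem, inner_monomial_outerProj_self,
    RCLike.re_eq_complex_re, Complex.ofReal_re]

theorem norm_sq_sub_outerProj_monomial (k : ℤ) :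
    ‖monomial hq k - outerProj (monomial hq k)‖ ^ 2 =
      2 * Real.pi * Real.exp (k * Real.log q) ^ 2 := by
  rw [norm_sub_sq (𝕜 := ℂ), inner_monomial_outerProj_self, norm_sq_outerProj_monomial,
    norm_sq_monomial, RCLike.re_eq_complex_re, Complex.ofReal_re]
  ring

theorem min_norm_outerProj_monomialBasis_le (k : ℤ) :
    min ‖outerProj (monomialBasis hq k : Lp ℂ 2 (boundaryMeasure q))‖
        ‖(monomialBasis hq k : Lp ℂ 2 (boundaryMeasure q)) - outerProj ↑(monomialBasis hq k)‖ ≤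
      Real.exp (-(-Real.log q * |(k : ℝ) + 0|)) := by
  set r := Real.exp (k * Real.log q)
  have hnorm := norm_sq_monomial hq k
  have houter := norm_sq_outerProj_monomial hq k
  have hinner := norm_sq_sub_outerProj_monomial hq k
  have hpos : 0 < ‖monomial hq k‖ := norm_pos_iff.2 (monomial_ne_zero hq k)
  rw [coe_monomialBasis, map_smul, ← smul_sub, norm_smul, norm_smul, Complex.norm_real, norm_inv,
    norm_norm, ← div_eq_inv_mul, ← div_eq_inv_mul, add_zero]
  obtain hk | hk := le_total 0 (k : ℝ)
  · refine min_le_of_right_le ((div_le_iff₀ hpos).2 ?_)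
    rw [abs_of_nonneg hk, neg_mul, neg_neg, mul_comm (Real.log q)]
    refine (sq_le_sq₀ (norm_nonneg _) (by positivity)).1 ?_
    rw [mul_pow, hinner, hnorm]
    nlinarith [Real.pi_pos, sq_nonneg (r ^ 2), mul_nonneg Real.pi_pos.le (sq_nonneg (r ^ 2))]
  · refine min_le_of_left_le ((div_le_iff₀ hpos).2 ?_)
    rw [abs_of_nonpos hk, neg_mul_neg, mul_comm (Real.log q), Real.exp_neg]
    refine (sq_le_sq₀ (norm_nonneg _) (by positivity)).1 ?_
    rw [mul_pow, houter, hnorm, inv_pow, inv_mul_eq_div, le_div_iff₀ (by positivity)]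
    gcongr
    exact le_add_of_nonneg_left zero_le_one

theorem outerProj_monomial_zero_notMem : outerProj (monomial hq 0) ∉ hardySpace hq 0 := by
  intro hmem
  have hrel := (mem_hardySpace_iff hq).1 hmem 0
  have hone := fourierCoef_outerProj_monomial_comp_circ_one hq 0
  rw [Int.cast_zero] at hone
  rw [Int.cast_zero, add_zero, hone, fourierCoef_outerProj_comp_circ hq, zero_mul, Real.exp_zero,
    Complex.ofReal_one, one_mul] at hrel
  exact zero_ne_one hrel

end OuterProjection

section SeparatedSymbol

variable {q : ℝ} (hq : q ∈ Ioo (0 : ℝ) 1)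

/-- Multiplication by a bounded function with bounded reciprocal, as an automorphism of `L²`. -/
def mulEquiv {X : Type*} [MeasurableSpace X] {ν : Measure X} {m n : X → ℂ} (hm : MemLp m ∞ ν)
    (hn : MemLp n ∞ ν) (hmn : ∀ᵐ z ∂ν, m z * n z = 1) : Lp ℂ 2 ν ≃L[ℂ] Lp ℂ 2 ν :=
  .equivOfInverse (mulOp hm) (mulOp hn)
    (mulOp_mulOp_cancel hn hm (hmn.mono fun _ h => (mul_comm _ _).trans h))
    (mulOp_mulOp_cancel hm hn hmn)

theorem summable_min_norm_outerProj_monomialBasis :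
    Summable fun k => min ‖outerProj (monomialBasis hq k : Lp ℂ 2 (boundaryMeasure q))‖
      ‖(monomialBasis hq k : Lp ℂ 2 (boundaryMeasure q)) - outerProj ↑(monomialBasis hq k)‖ :=
  .of_nonneg_of_le (fun _ => le_min (norm_nonneg _) (norm_nonneg _))
    (min_norm_outerProj_monomialBasis_le hq)
    (summable_exp_neg_mul_abs_add (neg_pos.2 (Real.log_neg hq.1 hq.2)) 0)

theorem memLp_ofReal_sqrt {w : ℂ → ℝ} {ν : Measure ℂ} [IsFiniteMeasure ν] (hw : MemLp w ∞ ν) :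
    MemLp (fun z => (Real.sqrt (w z) : ℂ)) ∞ ν := by
  refine .of_le (hw.norm.add (memLp_const 1)) ?_ (.of_forall fun z => ?_)
  · exact Complex.continuous_ofReal.comp_aestronglyMeasurable
      (Real.continuous_sqrt.comp_aestronglyMeasurable hw.1)
  · rw [Complex.norm_real, Real.norm_of_nonneg (Real.sqrt_nonneg _)]
    refine le_trans ?_ (le_abs_self _)
    simp only [Pi.add_apply, Real.norm_eq_abs]
    refine Real.sqrt_le_iff.2 ⟨by positivity, ?_⟩
    nlinarith [abs_nonneg (w z), le_abs_self (w z)]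

theorem memLp_ofReal_sqrt_inv {w : ℂ → ℝ} {ν : Measure ℂ} {δ : ℝ} (hδ : 0 < δ)
    (hw : AEStronglyMeasurable w ν) (hδw : ∀ᵐ z ∂ν, δ ≤ w z) :
    MemLp (fun z => (Real.sqrt (w z) : ℂ)⁻¹) ∞ ν := by
  refine memLp_top_of_bound (Complex.continuous_ofReal.comp_aestronglyMeasurable
    (Real.continuous_sqrt.comp_aestronglyMeasurable hw)).inv₀ (Real.sqrt δ)⁻¹ ?_
  filter_upwards [hδw] with z hz
  rw [norm_inv, Complex.norm_real, Real.norm_of_nonneg (Real.sqrt_nonneg _)]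
  exact inv_anti₀ (Real.sqrt_pos.2 hδ) (Real.sqrt_le_sqrt hz)

theorem exists_weighted_orthogonal {w : ℂ → ℝ} {δ : ℝ} (hδ : 0 < δ)
    (hw : MemLp w ∞ (boundaryMeasure q)) (hδw : ∀ᵐ z ∂boundaryMeasure q, δ ≤ w z) :
    ∃ μ ∈ Ioo (0 : ℝ) 1, ∃ f ∈ hardySpace hq 0, f ≠ 0 ∧ ∀ h ∈ hardySpace hq 0,
      ∫ z, starRingEnd ℂ (h z) * (w z * (outerIndicator z - μ) * f z) ∂boundaryMeasure q = 0 := by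
  have hm := memLp_ofReal_sqrt hw
  have hmn : ∀ᵐ z ∂boundaryMeasure q, (Real.sqrt (w z) : ℂ) * (Real.sqrt (w z) : ℂ)⁻¹ = 1 := by
    filter_upwards [hδw] with z hz
    exact mul_inv_cancel₀ (Complex.ofReal_ne_zero.2 (Real.sqrt_pos.2 (hδ.trans_le hz)).ne')
  obtain ⟨μ, hμ, f, hf, hf0, horth⟩ := exists_weighted_eigenvector (monomialBasis hq)
    isStarProjection_outerProj (mulEquiv hm (memLp_ofReal_sqrt_inv hδ hw.1 hδw) hmn)
    (mulOp_comm _ _) (summable_min_norm_outerProj_monomialBasis hq)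
    ⟨_, monomial_mem_hardySpace hq 0, outerProj_monomial_zero_notMem hq⟩
  refine ⟨μ, hμ, f, hf, hf0, fun h hh => ?_⟩
  rw [← horth h hh, inner_Lp_eq_integral]
  refine integral_congr_ae ?_
  filter_upwards [coeFn_mulOp hm h, coeFn_mulOp hm (outerProj f - (μ : ℂ) • f),
    Lp.coeFn_sub (outerProj f) ((μ : ℂ) • f), Lp.coeFn_smul (μ : ℂ) f,
    coeFn_mulOp memLp_outerIndicator f, hδw] with z hSh hSf hsub hsmul hproj hz
  have hsqrt : (w z : ℂ) = Real.sqrt (w z) * Real.sqrt (w z) := by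
    rw [← Complex.ofReal_mul, Real.mul_self_sqrt (hδ.le.trans hz)]
  change _ = starRingEnd ℂ (mulOp hm h z) * mulOp hm (outerProj f - (μ : ℂ) • f) z
  rw [hSh, hSf, hsub, Pi.sub_apply, hsmul, Pi.smul_apply, outerProj, hproj, map_mul,
    Complex.conj_ofReal, hsqrt, smul_eq_mul]
  ring

theorem mem_relativeEigenvalues_iff {φ : Lp ℝ ∞ (boundaryMeasure q)} {c : ℂ} :
    c ∈ relativeEigenvalues hq φ ↔ ∃ α : ℝ, ∃ g ∈ hardySpace hq α, g ≠ 0 ∧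
      ∀ h ∈ hardySpace hq α,
        ∫ z, starRingEnd ℂ (h z) * ((φ z - c) * g z) ∂boundaryMeasure q = 0 := by
  constructor
  · rintro ⟨α, -, g, hg0, hg⟩
    exact ⟨α, g, g.2, Subtype.coe_ne_coe.2 hg0, (toeplitz_eq_smul_iff hq).1 hg⟩
  · rintro ⟨α, g, hg, hg0, horth⟩
    have hfract : hardySpace hq (Int.fract α) = hardySpace hq α := by
      rw [← hardySpace_add_int hq (Int.fract α) ⌊α⌋, Int.fract_add_floor]
    rw [← hfract] at hg horth
    exact ⟨Int.fract α, ⟨Int.fract_nonneg α, Int.fract_lt_one α⟩, ⟨g, hg⟩,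
      Subtype.coe_ne_coe.1 hg0, (toeplitz_eq_smul_iff hq).2 horth⟩

theorem cpow_mul_cpow_neg (hq : 0 < q) (b : ℝ) :
    ∀ᵐ z ∂boundaryMeasure q, z ^ (b : ℂ) * z ^ ((-b : ℝ) : ℂ) = 1 := by
  filter_upwards [ae_ne_zero hq] with z hz
  rw [← Complex.cpow_add _ _ hz, Complex.ofReal_neg, add_neg_cancel, Complex.cpow_zero]

theorem mem_relativeEigenvalues_of_norm_cpow {φ : Lp ℝ ∞ (boundaryMeasure q)} {c : ℂ} (α : ℝ)
    {f : Lp ℂ 2 (boundaryMeasure q)} (hf : f ∈ hardySpace hq 0) (hf0 : f ≠ 0)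
    (horth : ∀ h ∈ hardySpace hq 0, ∫ z, starRingEnd ℂ (h z) *
      (‖z ^ (α : ℂ)‖ ^ 2 * (φ z - c) * f z) ∂boundaryMeasure q = 0) :
    c ∈ relativeEigenvalues hq φ := by
  let M := mulEquiv (memLp_cpow hq.1 α) (memLp_cpow hq.1 (-α)) (cpow_mul_cpow_neg hq.1 α)
  refine (mem_relativeEigenvalues_iff hq).2 ⟨α, M f, ?_, M.map_ne_zero_iff.2 hf0, fun h hh => ?_⟩
  · have h := mulOp_cpow_mem_hardySpace hq hf α
    rwa [zero_add] at h
  have hmem : M.symm h ∈ hardySpace hq 0 := by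
    have h := mulOp_cpow_mem_hardySpace hq hh (-α)
    rwa [add_neg_cancel] at h
  rw [← horth _ hmem]
  refine integral_congr_ae ?_
  have hMh : h =ᵐ[boundaryMeasure q] fun z => z ^ (α : ℂ) * M.symm h z := by
    conv_lhs => rw [← M.apply_symm_apply h]
    exact coeFn_mulOp _ _
  filter_upwards [hMh, coeFn_mulOp (memLp_cpow hq.1 α) f] with z hh hf
  change _ * (_ * mulOp _ f z) = _
  rw [hh, hf, map_mul, ← Complex.conj_mul']
  ring

theorem exists_exp_mul_sq_eq {a x : ℝ} (ha : a ≠ 0) (hx : 0 < x) :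
    ∃ b : ℝ, Real.exp (b * a) ^ 2 = x := by
  refine ⟨Real.log x / (2 * a), ?_⟩
  rw [← Real.exp_nat_mul, Nat.cast_ofNat, div_mul_eq_mul_div, mul_div_mul_right _ _ ha,
    mul_div_cancel₀ _ two_ne_zero, Real.exp_log hx]

theorem norm_cpow_sq_mul_sub_ae_eq (hq : q ∈ Ioo (0 : ℝ) 1) {φ w : ℂ → ℝ} {l ε μ α : ℝ}
    (hε : ε ≠ 0) (hμ : 1 - μ ≠ 0)
    (hα : Real.exp (α * Real.log q) ^ 2 = μ / (1 - μ))
    (houter : ∀ᵐ t ∂angle, w (circ 1 t) = ε * (φ (circ 1 t) - l))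
    (hinner : ∀ᵐ t ∂angle, w (circ q t) = ε * (l - φ (circ q t))) :
    ∀ᵐ z ∂boundaryMeasure q, (‖z ^ (α : ℂ)‖ ^ 2 * (φ z - l) : ℂ) =
      (ε * (1 - μ) : ℂ)⁻¹ * (w z * (outerIndicator z - μ)) := by
  have hε' : (ε : ℂ) ≠ 0 := Complex.ofReal_ne_zero.2 hε
  have hμ' : (1 - μ : ℂ) ≠ 0 := by exact_mod_cast hμ
  refine (ae_boundaryMeasure_iff hq.1).2 ⟨?_, ?_⟩
  · filter_upwards [houter] with t ht
    rw [norm_circ_cpow one_pos, Real.log_one, mul_zero, Real.exp_zero, ht,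
      outerIndicator_circ_one]
    push_cast
    field_simp
  · filter_upwards [hinner] with t ht
    rw [norm_circ_cpow hq.1, ← Complex.ofReal_pow, hα, ht, outerIndicator_circ hq]
    push_cast
    field_simp
    ring

theorem mem_relativeEigenvalues_of_separated (φ : Lp ℝ ∞ (boundaryMeasure q)) {l δ ε : ℝ}
    (hδ : 0 < δ) (hε : ε ≠ 0) (houter : ∀ᵐ t ∂angle, δ ≤ ε * (φ (circ 1 t) - l))
    (hinner : ∀ᵐ t ∂angle, δ ≤ ε * (l - φ (circ q t))) :
    (l : ℂ) ∈ relativeEigenvalues hq φ := by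
  let w (z : ℂ) : ℝ := |ε * (φ z - l)|
  have hw : MemLp w ∞ (boundaryMeasure q) :=
    (((Lp.memLp φ).sub (memLp_top_const l)).const_mul ε).norm
  have hw_outer : ∀ᵐ t ∂angle, w (circ 1 t) = ε * (φ (circ 1 t) - l) :=
    houter.mono fun t ht => abs_of_pos (hδ.trans_le ht)
  have hw_inner : ∀ᵐ t ∂angle, w (circ q t) = ε * (l - φ (circ q t)) :=
    hinner.mono fun t ht => by
      rw [← abs_of_pos (hδ.trans_le ht), ← abs_neg, neg_mul_eq_mul_neg, neg_sub]
  have hδw : ∀ᵐ z ∂boundaryMeasure q, δ ≤ w z := (ae_boundaryMeasure_iff hq.1).2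
    ⟨by filter_upwards [houter, hw_outer] with t h hw using h.trans_eq hw.symm,
      by filter_upwards [hinner, hw_inner] with t h hw using h.trans_eq hw.symm⟩
  obtain ⟨μ, ⟨hμ0, hμ1⟩, f, hf, hf0, horth⟩ := exists_weighted_orthogonal hq hδ hw hδw
  have hμ1' : 1 - μ ≠ 0 := (sub_pos.2 hμ1).ne'
  obtain ⟨α, hα⟩ := exists_exp_mul_sq_eq (Real.log_neg hq.1 hq.2).ne (div_pos hμ0 (sub_pos.2 hμ1))
  refine mem_relativeEigenvalues_of_norm_cpow hq α hf hf0 fun h hh => ?_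
  rw [← mul_zero (ε * (1 - μ) : ℂ)⁻¹, ← horth h hh, ← integral_const_mul]
  refine integral_congr_ae
    ((norm_cpow_sq_mul_sub_ae_eq hq hε hμ1' hα hw_outer hw_inner).mono fun z hz => ?_)
  simp only [hz]
  ring

end SeparatedSymbol

section Product

theorem tendsto_eLpNorm_one_mul {X ι 𝕜 : Type*} [MeasurableSpace X] [NormedField 𝕜]
    {μ : Measure X} {l : Filter ι} {f g : ι → X → 𝕜} {u v : X → 𝕜}
    (hf : ∀ᶠ i in l, MemLp (f i) 2 μ) (hg : ∀ᶠ i in l, MemLp (g i) 2 μ)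
    (hu : MemLp u 2 μ) (hv : MemLp v 2 μ)
    (hfu : Tendsto (fun i => eLpNorm (f i - u) 2 μ) l (𝓝 0))
    (hgv : Tendsto (fun i => eLpNorm (g i - v) 2 μ) l (𝓝 0)) :
    Tendsto (fun i => eLpNorm (f i * g i - u * v) 1 μ) l (𝓝 0) := by
  have hbound := ((ENNReal.Tendsto.mul hfu (Or.inr ENNReal.zero_ne_top) hgv
    (Or.inr ENNReal.zero_ne_top)).add (ENNReal.Tendsto.mul_const hfu (Or.inr hv.2.ne))).add
    (ENNReal.Tendsto.const_mul hgv (Or.inr hu.2.ne))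
  simp only [mul_zero, zero_mul, add_zero] at hbound
  refine tendsto_of_tendsto_of_tendsto_of_le_of_le' tendsto_const_nhds hbound
    (Eventually.of_forall fun _ => zero_le) ?_
  filter_upwards [hf, hg] with i hfi hgi
  have hsplit : f i * g i - u * v = (f i - u) • (g i - v) + (f i - u) • v + u • (g i - v) := by
    simp only [smul_eq_mul]
    ring
  have hdf := (hfi.sub hu).1
  have hdg := (hgi.sub hv).1
  rw [hsplit]
  refine (eLpNorm_add_le ((hdf.smul hdg).add (hdf.smul hv.1)) (hu.1.smul hdg) le_rfl).trans
    (add_le_add ((eLpNorm_add_le (hdf.smul hdg) (hdf.smul hv.1) le_rfl).trans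
      (add_le_add ?_ ?_)) ?_)
  exacts [eLpNorm_smul_le_mul_eLpNorm hdg hdf, eLpNorm_smul_le_mul_eLpNorm hv.1 hdf,
    eLpNorm_smul_le_mul_eLpNorm hdg hu.1]

variable {q α β : ℝ} {F G : ℂ → ℂ}

theorem IsAutomorphic.mul (hF : IsAutomorphic q α F) (hG : IsAutomorphic q β G) :
    IsAutomorphic q (α + β) (F * G) where
  analytic := hF.analytic.mul hG.analytic
  index w hw := by
    rw [Complex.ofReal_add, mul_add, Complex.exp_add, Pi.mul_apply, Pi.mul_apply, hF.index w hw,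
      hG.index w hw]
    ring

theorem isOpen_cover (q : ℝ) : IsOpen (cover q) := isOpen_Ioo.preimage Complex.continuous_re

theorem isPreconnected_cover (q : ℝ) : IsPreconnected (cover q) :=
  ((convex_Ioo (Real.log q) 0).linear_preimage Complex.reLm).isPreconnected

theorem eqOn_zero_of_slice_ae_eq_zero (hq : q ∈ Ioo 0 1) (hF : DifferentiableOn ℂ F (cover q))
    (h : ∀ s ∈ Ioo (Real.log q) 0, slice F s =ᵐ[angle] 0) : EqOn F 0 (cover q) := by
  have hslice (s) (hs : s ∈ Ioo (Real.log q) 0) : EqOn (slice F s) 0 (Ioo (-Real.pi) Real.pi) :=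
    Measure.eqOn_open_of_ae_eq (ae_restrict_of_ae_restrict_of_subset Ioo_subset_Ioc_self (h s hs))
      isOpen_Ioo (continuous_slice hF hs).continuousOn continuousOn_const
  obtain ⟨s, hs⟩ := nonempty_Ioo.2 (Real.log_neg hq.1 hq.2)
  refine (hF.analyticOnNhd (isOpen_cover q)).eqOn_zero_of_preconnected_of_eventuallyEq_zero
    (isPreconnected_cover q) (z₀ := (s : ℂ)) (by simpa [cover] using hs) ?_
  filter_upwards [(isOpen_Ioo.reProdIm isOpen_Ioo).mem_nhds
    (show (s : ℂ) ∈ Ioo (Real.log q) 0 ×ℂ Ioo (-Real.pi) Real.pi by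
      simpa [Complex.mem_reProdIm, Real.pi_pos] using hs)] with w hw
  have hw₀ := hslice w.re hw.1 hw.2
  rwa [slice, Complex.re_add_im] at hw₀

theorem IsAutomorphic.eqOn_zero_of_tendsto (hq : q ∈ Ioo 0 1) (hF : IsAutomorphic q α F)
    (hlim : Tendsto (fun s => eLpNorm (slice F s) 1 angle) (𝓝[<] 0) (𝓝 0)) :
    EqOn F 0 (cover q) := by
  refine eqOn_zero_of_slice_ae_eq_zero hq hF.analytic fun s hs =>
    ae_eq_zero_of_fourierCoef_eq_zero (memLp_slice hF.analytic hs 2) α fun k => ?_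
  have hcoef := fourierCoef_slice_of_tendsto hF (integrable_zero ℝ ℂ angle) nhdsWithin_le_nhds
    (Ioo_mem_nhdsLT (Real.log_neg hq.1 hq.2)) (by simpa using hlim) k hs
  simpa [fourierCoef] using hcoef

theorem HasBoundaryValue.ae_eq_zero_of_eqOn (hq : q ∈ Ioo 0 1) {g : ℂ → ℂ}
    (hg : AEStronglyMeasurable g (boundaryMeasure q)) (hF : EqOn F 0 (cover q))
    (hFg : HasBoundaryValue q F g) : g =ᵐ[boundaryMeasure q] 0 := by
  have hlog := Real.log_neg hq.1 hq.2
  have hslice (s) (hs : s ∈ Ioo (Real.log q) 0) : slice F s = 0 :=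
    funext fun t => hF (mem_cover_add_mul_I hs t)
  have hcirc {ρ : ℝ} {l : Filter ℝ} [l.NeBot] (hl : Ioo (Real.log q) 0 ∈ l)
      (hρ : Measure.QuasiMeasurePreserving (circ ρ) angle (boundaryMeasure q))
      (hlim : Tendsto (fun s => eLpNorm (slice F s - g ∘ circ ρ) 2 angle) l (𝓝 0)) :
      g ∘ circ ρ =ᵐ[angle] 0 := by
    rw [← eLpNorm_eq_zero_iff (hg.comp_quasiMeasurePreserving hρ) two_ne_zero]
    refine tendsto_nhds_unique (tendsto_const_nhds.congr' ?_) hlim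
    filter_upwards [hl] with s hs
    rw [hslice s hs, zero_sub, eLpNorm_neg]
  exact (ae_boundaryMeasure_iff hq.1).2
    ⟨hcirc (Ioo_mem_nhdsLT hlog) (quasi_one q) hFg.outer_circle,
      hcirc (Ioo_mem_nhdsGT hlog) (quasi_q q) hFg.inner_circle⟩

theorem eq_zero_or_eq_zero_of_mul_ae_eq_zero {hq : q ∈ Ioo (0 : ℝ) 1}
    {g h : Lp ℂ 2 (boundaryMeasure q)} (hg : g ∈ hardySpace hq α) (hh : h ∈ hardySpace hq β)
    (hgh : ∀ᵐ t ∂angle, g (circ 1 t) * h (circ 1 t) = 0) : g = 0 ∨ h = 0 := by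
  obtain ⟨F, hF, hFg⟩ := hg
  obtain ⟨G, hG, hGh⟩ := hh
  have hmem : Ioo (Real.log q) 0 ∈ 𝓝[<] (0 : ℝ) := Ioo_mem_nhdsLT (Real.log_neg hq.1 hq.2)
  have hlim := tendsto_eLpNorm_one_mul
    (mem_of_superset hmem fun s hs => memLp_slice hF.analytic hs 2)
    (mem_of_superset hmem fun s hs => memLp_slice hG.analytic hs 2)
    (memLp_comp_circ (circleMeasure_one_le q) (Lp.memLp g))
    (memLp_comp_circ (circleMeasure_one_le q) (Lp.memLp h)) hFg.outer_circle hGh.outer_circle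
  have hFG : EqOn (F * G) 0 (cover q) := by
    refine (hF.isAutomorphic.mul hG.isAutomorphic).eqOn_zero_of_tendsto hq
      (hlim.congr fun s => eLpNorm_congr_ae ?_)
    filter_upwards [hgh] with t ht
    simp only [Pi.sub_apply, Pi.mul_apply, Function.comp_apply, ht, sub_zero, slice]
  refine (AnalyticOnNhd.eq_zero_or_eq_zero_of_mul_eq_zero
    (hF.analytic.analyticOnNhd (isOpen_cover q)) (hG.analytic.analyticOnNhd (isOpen_cover q)) hFG
    (isPreconnected_cover q)).imp (fun hF₀ => ?_) fun hG₀ => ?_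
  · exact Lp.eq_zero_iff_ae_eq_zero.2 (hFg.ae_eq_zero_of_eqOn hq (Lp.aestronglyMeasurable g) hF₀)
  · exact Lp.eq_zero_iff_ae_eq_zero.2 (hGh.ae_eq_zero_of_eqOn hq (Lp.aestronglyMeasurable h) hG₀)

end Product

section Annihilator

theorem ae_eq_fourierCoef_zero {f : ℝ → ℂ} (hf : Integrable f angle)
    (h : ∀ k : ℤ, k ≠ 0 → fourierCoef k f = 0) : f =ᵐ[angle] fun _ => fourierCoef 0 f := by
  have hconst : (fun _ => fourierCoef 0 f) = fourierCoef 0 f • expChar 0 := by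
    funext t
    simp
  rw [← sub_ae_eq_zero]
  refine ae_eq_zero_of_fourierCoef_int_eq_zero (hf.sub (integrable_const _)) fun k => ?_
  have hk := fourierCoef_expChar k 0 0
  simp only [Int.cast_zero, add_zero] at hk
  rw [fourierCoef_sub hf (integrable_const _), hconst, fourierCoef_smul, hk]
  obtain rfl | hk₀ := eq_or_ne k 0
  · simp
  · simp [h k hk₀, hk₀]

theorem fourierCoef_neg_ofReal (b : ℝ) (u : ℝ → ℝ) :
    fourierCoef (-b) (fun t => (u t : ℂ)) =
      starRingEnd ℂ (fourierCoef b fun t => (u t : ℂ)) := by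
  simp only [fourierCoef, Complex.real_smul, map_mul, Complex.conj_ofReal, ← integral_conj,
    expChar_neg]

theorem circ_zpow (ρ : ℝ) (n : ℤ) (t : ℝ) : circ ρ t ^ n = (ρ ^ n : ℝ) * expChar n t := by
  rw [circ, mul_zpow, ← Complex.exp_int_mul, expChar]
  push_cast
  ring_nf

variable {q : ℝ} {ν : ℂ → ℝ}

theorem fourierCoef_add_zpow_mul_eq_zero (hq : q ∈ Ioo 0 1)
    (hν : Integrable ν (boundaryMeasure q)) {n : ℤ}
    (h : ∫ z, starRingEnd ℂ (z ^ n) * ν z ∂boundaryMeasure q = 0) :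
    fourierCoef n (fun t => (ν (circ 1 t) : ℂ)) +
      (q ^ n : ℝ) * fourierCoef n (fun t => (ν (circ q t) : ℂ)) = 0 := by
  have hint : Integrable (fun z => starRingEnd ℂ (z ^ n) * ν z) (boundaryMeasure q) := by
    have hbdd : ∀ᵐ z ∂boundaryMeasure q, ‖starRingEnd ℂ (z ^ n)‖ ≤ max 1 (q ^ n) := by
      simp only [RCLike.norm_conj, norm_zpow]
      refine (ae_boundaryMeasure_iff hq.1).2 ⟨.of_forall fun t => ?_, .of_forall fun t => ?_⟩
      · simp [norm_circ]
      · simp [norm_circ hq.1.le]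
    have hmeas : Measurable fun z : ℂ => starRingEnd ℂ (z ^ n) :=
      Complex.continuous_conj.measurable.comp (by fun_prop)
    exact hν.ofReal.bdd_mul hmeas.aestronglyMeasurable hbdd
  have hcoef (ρ : ℝ) : (ρ ^ n : ℝ) * fourierCoef n (fun t => (ν (circ ρ t) : ℂ)) =
      (2 * Real.pi)⁻¹ • ∫ t, starRingEnd ℂ (circ ρ t ^ n) * ν (circ ρ t) ∂angle := by
    rw [fourierCoef, mul_smul_comm, ← integral_const_mul]
    simp only [circ_zpow, map_mul, Complex.conj_ofReal, expChar_neg]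
    congr 2
    funext t
    ring
  have hone := hcoef 1
  rw [one_zpow, Complex.ofReal_one, one_mul] at hone
  rw [hone, hcoef, ← smul_add, ← integral_boundaryMeasure hint, h, smul_zero]

theorem fourierCoef_eq_zero_of_annihilates (hq : q ∈ Ioo 0 1)
    (hν : Integrable ν (boundaryMeasure q))
    (h : ∀ n : ℤ, ∫ z, starRingEnd ℂ (z ^ n) * ν z ∂boundaryMeasure q = 0) {n : ℤ} (hn : n ≠ 0) :
    fourierCoef n (fun t => (ν (circ 1 t) : ℂ)) = 0 ∧
      fourierCoef n (fun t => (ν (circ q t) : ℂ)) = 0 := by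
  have hpos := fourierCoef_add_zpow_mul_eq_zero hq hν (h n)
  -- As `ν` is real, conjugating the relation for `-n` gives a second relation for `n`.
  have hneg := congrArg (starRingEnd ℂ) (fourierCoef_add_zpow_mul_eq_zero hq hν (h (-n)))
  rw [Int.cast_neg, fourierCoef_neg_ofReal, fourierCoef_neg_ofReal, map_add, map_mul,
    Complex.conj_conj, Complex.conj_conj, Complex.conj_ofReal, map_zero] at hneg
  have hdiff : ((q ^ n - q ^ (-n) : ℝ) : ℂ) * fourierCoef n (fun t => (ν (circ q t) : ℂ)) = 0 := by
    push_cast at hpos hneg ⊢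
    linear_combination hpos - hneg
  have hne : q ^ n - q ^ (-n) ≠ 0 := by
    rw [sub_ne_zero, (zpow_right_injective₀ hq.1 hq.2.ne).ne_iff]
    omega
  have hinner := (mul_eq_zero.1 hdiff).resolve_left (Complex.ofReal_ne_zero.2 hne)
  rw [hinner, mul_zero, add_zero] at hpos
  exact ⟨hpos, hinner⟩

theorem exists_ae_eq_const_of_annihilates (hq : q ∈ Ioo 0 1)
    (hν : Integrable ν (boundaryMeasure q))
    (h : ∀ n : ℤ, ∫ z, starRingEnd ℂ (z ^ n) * ν z ∂boundaryMeasure q = 0) :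
    ∃ d : ℝ, (∀ᵐ t ∂angle, ν (circ 1 t) = d) ∧ ∀ᵐ t ∂angle, ν (circ q t) = -d := by
  have hcirc {ρ : ℝ} (hρ : circleMeasure ρ ≤ boundaryMeasure q) :
      Integrable (fun t => (ν (circ ρ t) : ℂ)) angle :=
    (memLp_one_iff_integrable.1 (memLp_comp_circ hρ (memLp_one_iff_integrable.2 hν))).ofReal
  have houter := ae_eq_fourierCoef_zero (hcirc (circleMeasure_one_le q)) fun n hn =>
    (fourierCoef_eq_zero_of_annihilates hq hν h hn).1
  have hinner := ae_eq_fourierCoef_zero (hcirc (circleMeasure_inner_le q)) fun n hn =>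
    (fourierCoef_eq_zero_of_annihilates hq hν h hn).2
  have hsum := fourierCoef_add_zpow_mul_eq_zero hq hν (h 0)
  rw [Int.cast_zero, zpow_zero, Complex.ofReal_one, one_mul] at hsum
  refine ⟨(fourierCoef 0 fun t => (ν (circ 1 t) : ℂ)).re, ?_, ?_⟩
  · filter_upwards [houter] with t ht
    rw [← ht, Complex.ofReal_re]
  · filter_upwards [hinner] with t ht
    rw [eq_neg_of_add_eq_zero_left hsum, Complex.neg_re, neg_neg, ← ht, Complex.ofReal_re]

end Annihilator

section Eigenvalues

variable {q : ℝ} {φ : Lp ℝ ∞ (boundaryMeasure q)}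

theorem inner_lpSMul_left (φ : Lp ℝ ∞ (boundaryMeasure q)) (f g : Lp ℂ 2 (boundaryMeasure q)) :
    inner ℂ (φ • f : Lp ℂ 2 (boundaryMeasure q)) g =
      inner ℂ f (φ • g : Lp ℂ 2 (boundaryMeasure q)) := by
  rw [inner_Lp_eq_integral, inner_Lp_eq_integral]
  refine integral_congr_ae ?_
  filter_upwards [Lp.coeFn_lpSMul (r := 2) φ f, Lp.coeFn_lpSMul (r := 2) φ g] with z hf hg
  rw [hf, hg, Pi.smul_apply', Pi.smul_apply', Complex.real_smul, Complex.real_smul, map_mul,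
    Complex.conj_ofReal]
  ring

variable {hq : q ∈ Ioo (0 : ℝ) 1}

theorem conj_eq_of_mem_relativeEigenvalues {c : ℂ} (hc : c ∈ relativeEigenvalues hq φ) :
    starRingEnd ℂ c = c := by
  obtain ⟨α, -, ⟨g, hg⟩, hg₀, hgc⟩ := hc
  rw [toeplitz] at hgc
  have hclosure : (hardySpace hq α).topologicalClosure.starProjection g = g :=
    Submodule.starProjection_eq_self_iff.2 (Submodule.le_topologicalClosure _ hg)
  have hinner : inner ℂ g g ≠ 0 := inner_self_ne_zero.2 fun h => hg₀ (Subtype.ext h)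
  refine mul_right_cancel₀ hinner ?_
  rw [← inner_smul_left, ← inner_smul_right, ← hgc,
    Submodule.inner_starProjection_left_eq_right _ _ g, hclosure,
    ← Submodule.inner_starProjection_left_eq_right _ g, hclosure]
  exact inner_lpSMul_left φ g g

theorem norm_le_of_mem_relativeEigenvalues {c : ℂ} (hc : c ∈ relativeEigenvalues hq φ) :
    ‖c‖ ≤ ‖φ‖ := by
  obtain ⟨α, -, ⟨g, hg⟩, hg₀, hgc⟩ := hc
  refine le_of_mul_le_mul_right ?_ (norm_pos_iff.2 fun h : g = 0 => hg₀ (Subtype.ext h))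
  calc ‖c‖ * ‖g‖ = ‖toeplitz hq α φ ⟨g, hg⟩‖ := by rw [hgc, norm_smul]
    _ ≤ ‖(φ • g : Lp ℂ 2 (boundaryMeasure q))‖ := Submodule.norm_starProjection_apply_le _ _
    _ ≤ ‖φ‖ * ‖g‖ := Lp.norm_smul_le φ g

theorem integrable_sub_mul_norm_sq (φ : Lp ℝ ∞ (boundaryMeasure q)) (l : ℝ)
    (g : Lp ℂ 2 (boundaryMeasure q)) :
    Integrable (fun z => (φ z - l) * ‖g z‖ ^ 2) (boundaryMeasure q) := by
  refine (integrable_conj_mul g (φ • g - (l : ℂ) • g)).re.congr ?_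
  filter_upwards [Lp.coeFn_sub (φ • g : Lp ℂ 2 (boundaryMeasure q)) ((l : ℂ) • g),
    Lp.coeFn_smul (l : ℂ) g, Lp.coeFn_lpSMul (r := 2) φ g] with z hsub hsmul hφ
  rw [hsub, Pi.sub_apply, hsmul, hφ, Pi.smul_apply', Pi.smul_apply, Complex.real_smul,
    smul_eq_mul, ← sub_mul, mul_left_comm, Complex.conj_mul']
  norm_cast

theorem exists_eigenfunction_sub_mul_norm_sq_eq {l : ℝ}
    (hl : (l : ℂ) ∈ relativeEigenvalues hq φ) :
    ∃ α : ℝ, ∃ g ∈ hardySpace hq α, g ≠ 0 ∧ ∃ d : ℝ,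
      (∀ᵐ t ∂angle, (φ (circ 1 t) - l) * ‖g (circ 1 t)‖ ^ 2 = d) ∧
      ∀ᵐ t ∂angle, (φ (circ q t) - l) * ‖g (circ q t)‖ ^ 2 = -d := by
  obtain ⟨α, g, hg, hg₀, horth⟩ := (mem_relativeEigenvalues_iff hq).1 hl
  refine ⟨α, g, hg, hg₀, exists_ae_eq_const_of_annihilates hq (integrable_sub_mul_norm_sq φ l g)
    fun n => ?_⟩
  have hmem := mulOp_cpow_mem_hardySpace hq hg n
  rw [hardySpace_add_int] at hmem
  rw [← horth _ hmem]
  refine integral_congr_ae ?_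
  filter_upwards [coeFn_mulOp (memLp_cpow hq.1 n) g] with z hz
  rw [hz, Complex.ofReal_intCast, Complex.cpow_intCast, map_mul]
  push_cast
  rw [← Complex.conj_mul' (g z)]
  ring

theorem frequently_outer_ne_zero {α : ℝ} {g : Lp ℂ 2 (boundaryMeasure q)}
    (hg : g ∈ hardySpace hq α) (hg₀ : g ≠ 0) : ∃ᶠ t in ae angle, g (circ 1 t) ≠ 0 := fun h =>
  hg₀ <| or_self_iff.1 <| eq_zero_or_eq_zero_of_mul_ae_eq_zero hg hg <|
    h.mono fun t ht => by rw [not_not.1 ht, zero_mul]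

theorem frequently_inner_ne_zero {α : ℝ} {g : Lp ℂ 2 (boundaryMeasure q)}
    (hg : g ∈ hardySpace hq α) (hg₀ : g ≠ 0) : ∃ᶠ t in ae angle, g (circ q t) ≠ 0 := by
  refine fun h => hg₀ (eq_zero_of_fourierCoef_eq_zero hq hg fun k => ?_)
  have hinner : fourierCoef (k + α) (g ∘ circ q) = 0 := by
    have hzero : g ∘ circ q =ᵐ[angle] 0 := h.mono fun t ht => not_not.1 ht
    rw [fourierCoef_congr hzero]
    simp [fourierCoef]
  have hrel := (mem_hardySpace_iff hq).1 hg k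
  rw [hinner, eq_comm, mul_eq_zero] at hrel
  exact hrel.resolve_left (Complex.ofReal_ne_zero.2 (Real.exp_ne_zero _))

/-- The eigenvalue `l` is degenerate: it has an eigenfunction `g` of multiplication by `φ`, that is,
one with `φ g = l g` before projecting. -/
def IsDegenerateEigenvalue (hq : q ∈ Ioo (0 : ℝ) 1) (φ : Lp ℝ ∞ (boundaryMeasure q)) (l : ℝ) :
    Prop :=
  ∃ α : ℝ, ∃ g ∈ hardySpace hq α, g ≠ 0 ∧ ∀ᵐ z ∂boundaryMeasure q, φ z = l ∨ g z = 0

variable {l : ℝ}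

theorem IsDegenerateEigenvalue.frequently_outer (h : IsDegenerateEigenvalue hq φ l) :
    ∃ᶠ t in ae angle, φ (circ 1 t) = l := by
  obtain ⟨α, g, hg, hg₀, hφ⟩ := h
  exact ((frequently_outer_ne_zero hg hg₀).and_eventually
    (ae_comp_circ (circleMeasure_one_le q) hφ)).mono fun t ht => ht.2.resolve_right ht.1

theorem IsDegenerateEigenvalue.frequently_inner (h : IsDegenerateEigenvalue hq φ l) :
    ∃ᶠ t in ae angle, φ (circ q t) = l := by
  obtain ⟨α, g, hg, hg₀, hφ⟩ := h
  exact ((frequently_inner_ne_zero hg hg₀).and_eventually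
    (ae_comp_circ (circleMeasure_inner_le q) hφ)).mono fun t ht => ht.2.resolve_right ht.1

theorem IsDegenerateEigenvalue.eq {l' : ℝ} (h : IsDegenerateEigenvalue hq φ l)
    (h' : IsDegenerateEigenvalue hq φ l') : l = l' := by
  obtain ⟨α, g, hg, hg₀, hφ⟩ := h
  obtain ⟨β, k, hk, hk₀, hφ'⟩ := h'
  by_contra hne
  refine (eq_zero_or_eq_zero_of_mul_ae_eq_zero hg hk ?_).elim hg₀ hk₀
  refine ae_comp_circ (circleMeasure_one_le q) (P := fun z => g z * k z = 0) ?_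
  filter_upwards [hφ, hφ'] with z hz hz'
  refine mul_eq_zero.2 (hz.elim (fun hzl => Or.inr (hz'.resolve_left fun hzl' => ?_)) Or.inl)
  exact hne (hzl.symm.trans hzl')

theorem symbol_trichotomy (hl : (l : ℂ) ∈ relativeEigenvalues hq φ) :
    ((∀ᵐ t ∂angle, l < φ (circ 1 t)) ∧ ∀ᵐ t ∂angle, φ (circ q t) < l) ∨
      ((∀ᵐ t ∂angle, φ (circ 1 t) < l) ∧ ∀ᵐ t ∂angle, l < φ (circ q t)) ∨
      IsDegenerateEigenvalue hq φ l := by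
  obtain ⟨α, g, hg, hg₀, d, houter, hinner⟩ := exists_eigenfunction_sub_mul_norm_sq_eq hl
  have hpos {x y : ℝ} (h : 0 < (x - l) * y ^ 2) : l < x :=
    sub_pos.1 (pos_of_mul_pos_left h (sq_nonneg y))
  have hneg {x y : ℝ} (h : (x - l) * y ^ 2 < 0) : x < l :=
    sub_neg.1 (neg_of_mul_neg_left h (sq_nonneg y))
  rcases lt_trichotomy d 0 with hd | rfl | hd
  · exact Or.inr (Or.inl ⟨houter.mono fun t ht => hneg (ht.trans_lt hd),
      hinner.mono fun t ht => hpos (ht ▸ neg_pos.2 hd)⟩)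
  · refine Or.inr (Or.inr ⟨α, g, hg, hg₀, (ae_boundaryMeasure_iff hq.1).2
      ⟨houter.mono fun t ht => ?_, hinner.mono fun t ht => ?_⟩⟩)
    · simpa [sub_eq_zero] using ht
    · simpa [sub_eq_zero] using ht
  · exact Or.inl ⟨houter.mono fun t ht => hpos (ht ▸ hd),
      hinner.mono fun t ht => hneg (ht.trans_lt (neg_neg_of_pos hd))⟩

end Eigenvalues

section Classification

theorem mem_relativeEigenvalues_of_lt_of_lt {q : ℝ} {hq : q ∈ Ioo (0 : ℝ) 1}
    {φ : Lp ℝ ∞ (boundaryMeasure q)} {l₁ l l₂ : ℝ} (h₁ : (l₁ : ℂ) ∈ relativeEigenvalues hq φ)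
    (h₂ : (l₂ : ℂ) ∈ relativeEigenvalues hq φ) (hl₁ : l₁ < l) (hl₂ : l < l₂) :
    (l : ℂ) ∈ relativeEigenvalues hq φ := by
  have hδ : 0 < min (l - l₁) (l₂ - l) := lt_min (sub_pos.2 hl₁) (sub_pos.2 hl₂)
  have hδ₁ : min (l - l₁) (l₂ - l) ≤ l - l₁ := min_le_left _ _
  have hδ₂ : min (l - l₁) (l₂ - l) ≤ l₂ - l := min_le_right _ _
  rcases symbol_trichotomy h₁ with ⟨-, hinner₁⟩ | ⟨houter₁, -⟩ | hdeg₁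
  · have houter₂ : ∀ᵐ t ∂angle, l₂ < φ (circ 1 t) := by
      rcases symbol_trichotomy h₂ with ⟨houter₂, -⟩ | ⟨-, hinner₂⟩ | hdeg₂
      · exact houter₂
      · obtain ⟨t, ht₁, ht₂⟩ := (hinner₁.and hinner₂).exists
        linarith
      · obtain ⟨t, ht₂, ht₁⟩ := (hdeg₂.frequently_inner.and_eventually hinner₁).exists
        linarith
    exact mem_relativeEigenvalues_of_separated hq φ hδ one_ne_zero
      (houter₂.mono fun t ht => by linarith) (hinner₁.mono fun t ht => by linarith)
  · have hinner₂ : ∀ᵐ t ∂angle, l₂ < φ (circ q t) := by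
      rcases symbol_trichotomy h₂ with ⟨houter₂, -⟩ | ⟨-, hinner₂⟩ | hdeg₂
      · obtain ⟨t, ht₁, ht₂⟩ := (houter₁.and houter₂).exists
        linarith
      · exact hinner₂
      · obtain ⟨t, ht₂, ht₁⟩ := (hdeg₂.frequently_outer.and_eventually houter₁).exists
        linarith
    exact mem_relativeEigenvalues_of_separated hq φ hδ (neg_ne_zero.2 one_ne_zero)
      (houter₁.mono fun t ht => by linarith) (hinner₂.mono fun t ht => by linarith)
  · exfalso
    rcases symbol_trichotomy h₂ with ⟨houter₂, -⟩ | ⟨-, hinner₂⟩ | hdeg₂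
    · obtain ⟨t, ht₁, ht₂⟩ := (hdeg₁.frequently_outer.and_eventually houter₂).exists
      linarith
    · obtain ⟨t, ht₁, ht₂⟩ := (hdeg₁.frequently_inner.and_eventually hinner₂).exists
      linarith
    · exact (hl₁.trans hl₂).ne (hdeg₁.eq hdeg₂)

theorem ordConnected_relativeEigenvalues {q : ℝ} (hq : q ∈ Ioo (0 : ℝ) 1)
    (φ : Lp ℝ ∞ (boundaryMeasure q)) :
    OrdConnected {l : ℝ | (l : ℂ) ∈ relativeEigenvalues hq φ} := by
  refine ⟨fun x hx y hy l hl => ?_⟩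
  rcases hl.1.eq_or_lt with rfl | hxl
  · exact hx
  rcases hl.2.eq_or_lt with rfl | hly
  · exact hy
  exact mem_relativeEigenvalues_of_lt_of_lt hx hy hxl hly

theorem eq_Icc_Ico_Ioc_Ioo_of_ordConnected {α : Type*} [ConditionallyCompleteLinearOrder α]
    {S : Set α} (hS : S.OrdConnected) (hne : S.Nonempty) (hbelow : BddBelow S)
    (habove : BddAbove S) :
    S ∈ ({Icc (sInf S) (sSup S), Ico (sInf S) (sSup S), Ioc (sInf S) (sSup S),
      Ioo (sInf S) (sSup S)} : Set (Set α)) := by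
  refine mem_Icc_Ico_Ioc_Ioo_of_subset_of_subset (fun x hx => ?_)
    (subset_Icc_csInf_csSup hbelow habove)
  obtain ⟨y, hy, hyx⟩ := exists_lt_of_csInf_lt hne hx.1
  obtain ⟨z, hz, hxz⟩ := exists_lt_of_lt_csSup hne hx.2
  exact hS.out hy hz ⟨hyx.le, hxz.le⟩

theorem eq_empty_or_singleton_or_interval {α : Type*} [ConditionallyCompleteLinearOrder α]
    {S : Set α} (hS : S.OrdConnected) (hbelow : BddBelow S) (habove : BddAbove S) :
    S = ∅ ∨ (∃ a, S = {a}) ∨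
      ∃ m M, m < M ∧ (S = Ioo m M ∨ S = Ico m M ∨ S = Ioc m M ∨ S = Icc m M) := by
  rcases S.subsingleton_or_nontrivial with hsub | hnt
  · exact hsub.eq_empty_or_singleton.imp_right Or.inl
  obtain ⟨x, hx, y, hy, hxy⟩ := hnt.exists_lt
  refine Or.inr (Or.inr ⟨sInf S, sSup S,
    (csInf_le hbelow hx).trans_lt (hxy.trans_le (le_csSup habove hy)), ?_⟩)
  have hcases := eq_Icc_Ico_Ioc_Ioo_of_ordConnected hS hnt.nonempty hbelow habove
  simp only [mem_insert_iff, mem_singleton_iff] at hcases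
  tauto

end Classification

end AnnulusToeplitz

end

theorem corollary2p3 (q : ℝ) (hq : q ∈ Ioo (0 : ℝ) 1)
    (φ : Lp ℝ ∞ (AnnulusToeplitz.boundaryMeasure q)) :
    ∃ S : Set ℝ, AnnulusToeplitz.relativeEigenvalues hq φ = (fun x : ℝ => (x : ℂ)) '' S ∧
      (S = ∅ ∨ (∃ a : ℝ, S = {a}) ∨
        ∃ m M : ℝ, m < M ∧ (S = Ioo m M ∨ S = Ico m M ∨ S = Ioc m M ∨ S = Icc m M)) := by
  have hbound (l : ℝ) (hl : (l : ℂ) ∈ AnnulusToeplitz.relativeEigenvalues hq φ) :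
      l ∈ Icc (-‖φ‖) ‖φ‖ :=
    abs_le.1 (by simpa using AnnulusToeplitz.norm_le_of_mem_relativeEigenvalues hl)
  refine ⟨{l : ℝ | (l : ℂ) ∈ AnnulusToeplitz.relativeEigenvalues hq φ}, ?_,
    AnnulusToeplitz.eq_empty_or_singleton_or_interval
      (AnnulusToeplitz.ordConnected_relativeEigenvalues hq φ)
      (bddBelow_Icc.mono hbound) (bddAbove_Icc.mono hbound)⟩
  refine (image_preimage_eq_of_subset fun c hc => ?_).symm
  exact Complex.conj_eq_iff_real.1 (AnnulusToeplitz.conj_eq_of_mem_relativeEigenvalues hc) |>.imp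
    fun _ => Eq.symm
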